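/- Let $\Gamma$ be a group with identity $\varepsilon$ and let $R$ be a nonzero commutative ring with $1$. A groupoid $\mathcal G$ is a small category with all arrows invertible; $\mathcal G^{(0)}$ is its set of objects, identified with the identity arrows, and $\mathbf d,\mathbf c:\mathcal G\to\mathcal G^{(0)}$ are the domain and codomain maps; $gh$ is defined when $\mathbf d(g)=\mathbf c(h)$. Write $\mathcal G^x=\mathbf d^{-1}(x)$. A topological groupoid $\mathcal G$ is *ample* if $\mathbf d$ is a local homeomorphism, $\mathcal G^{(0)}$ is Hausdorff, and $\mathcal G$ has a basis of compact open bisections (compact open sets on which $\mathbf d$ and $\mathbf c$ are injective). It is *$\Gamma$-graded* by a continuous functor $\kappa:\mathcal G\to\Gamma$ ($\Gamma$ discrete); put $\mathcal G_\gamma=\kappa^{-1}(\gamma)$. It is *strongly graded* if $\mathcal G_\gamma\mathcal G_\delta=\mathcal G_{\gamma\delta}$ for all $\gamma,\delta\in\Gamma$. A *$\mathcal G$-sheaf of $R$-modules* is a local homeomorphism $p:E\to\mathcal G^{(0)}$ whose stalks $E_x=p^{-1}(x)$ are $R$-modules, with continuous zero section, addition $E\times_{\mathcal G^{(0)}}E\to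 E$ and scalar multiplication $R\times E\to E$ ($R$ discrete), together with a continuous right action $(e,g)\mapsto eg$, defined for $p(e)=\mathbf c(g)$, such that $p(eg)=\mathbf d(g)$, $e\,p(e)=e$, $(eg)h=e(gh)$, and each map $E_{\mathbf c(g)}\to E_{\mathbf d(g)}$, $e\mapsto eg$, is $R$-linear. Morphisms are the continuous equivariant maps over $\mathcal G^{(0)}$ that are $R$-linear on stalks. Such an $E$ is *graded* if $E_x=\bigoplus_{\gamma\in\Gamma}(E_x)_\gamma$ for submodules $(E_x)_\gamma$, each $E_\gamma=\bigcup_x(E_x)_\gamma$ is open in $E$, and $E_\gamma\mathcal G_\delta\subseteq E_{\gamma\delta}$ for all $\gamma,\delta\in\Gamma$; graded morphisms $\phi:E\to F$ are those with $\phi(E_\gamma)\subseteq F_\gamma$ for all $\gamma$. Let $\operatorname{Mod}_R\mathcal G_\varepsilon$ be the category of $\mathcal G_\varepsilon$-sheaves of $R$-modules and $\operatorname{Gr}_R\mathcal G$ the category of graded $\mathcal G$-sheaves of $R$-modules with graded morphisms. The *restriction functor* $\mathcal I:\operatorname{Gr}_R\mathcal G\to\operatorname{Mod}_R\mathcal G_\varepsilon$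 sends $E$ to $E_\varepsilon$ (with the subspace topology) and $\phi$ to its restriction $\phi_\varepsilon$. The *induction functor* $\mathcal J:\operatorname{Mod}_R\mathcal G_\varepsilon\to\operatorname{Gr}_R\mathcal G$ sends $E$ to $E\otimes_{\mathcal G_\varepsilon}\mathcal G=\bigcup_{x}E\otimes\mathcal G^x$ and $\phi$ to $\phi\otimes\operatorname{id}$. Here $E\otimes\mathcal G^x$ is the $R$-module generated by the symbols $e\otimes g$ ($e\in E$, $g\in\mathcal G^x$, $p(e)=\mathbf c(g)$) subject to $e\otimes g+e'\otimes g=(e+e')\otimes g$, $(re)\otimes g=r(e\otimes g)$ and $eh\otimes g=e\otimes hg$ for $h\in\mathcal G_\varepsilon$; its $\gamma$-component is spanned by the $e\otimes g$ with $g\in\mathcal G_\gamma$; the action is $(e\otimes g)k=e\otimes gk$; and the topology is generated by the sets $$\Big\{\sum_{i=1}^n\sum_{g\in\mathcal G^x}f_i(g)\,s_i(\mathbf c(g))\otimes g\ \Big|\ x\in U\Big\},$$ where $U\subseteq\mathcal G^{(0)}$ is compact and open, the $s_i$ are compactly supported continuous sections of $E$, and the $f_i:\mathcal G\to R$ lie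 in the $R$-linear span of the characteristic functions of compact open bisections. **Theorem.** Let $\mathcal G$ be a $\Gamma$-graded ample groupoid. Then $\mathcal G$ is strongly graded if and only if $\mathcal I$ and $\mathcal J$ are mutually inverse equivalences of categories, that is, $\mathcal J\mathcal I\cong\operatorname{id}_{\operatorname{Gr}_R\mathcal G}$ and $\mathcal I\mathcal J\cong\operatorname{id}_{\operatorname{Mod}_R\mathcal G_\varepsilon}$. -/

import Mathlib

open CategoryTheory TopologicalSpace Topology

universe u v w

namespace AmpleGrpd

set_option linter.unusedSectionVars false

/-! ### Topological, étale and ample groupoids -/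

/-- The set `𝒢` of all arrows of a groupoid with set of objects `X`.  An arrow `g : x ⟶ y` has
domain `𝐝(g) = x` and codomain `𝐜(g) = y`.  The product `g h` of two arrows with `𝐝(g) = 𝐜(h)`
is the composite `h ≫ g`. -/
@[ext]
structure Arr (X : Type u) [Groupoid.{u} X] : Type u where
  dom : X
  cod : X
  hom : dom ⟶ cod

/-- The set `𝒢^x` of all arrows with domain `x`. -/
@[ext]
structure Out {X : Type u} [Groupoid.{u} X] (x : X) : Type u where
  cod : X
  hom : x ⟶ cod

/-- An element of `𝒢^x`, seen in `𝒢`. -/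
def Out.toArr {X : Type u} [Groupoid.{u} X] {x : X} (g : Out x) : Arr X := ⟨x, g.cod, g.hom⟩

/-- The identity arrow of an object. -/
def unitArr {X : Type u} [Groupoid.{u} X] (x : X) : Arr X := ⟨x, x, 𝟙 x⟩

/-- The inverse of an arrow. -/
def Arr.inverse {X : Type u} [Groupoid.{u} X] (g : Arr X) : Arr X :=
  ⟨g.cod, g.dom, Groupoid.inv g.hom⟩

/-- The set `𝒢⁽²⁾` of all composable pairs `(g, h)`, `𝐝(g) = 𝐜(h)`. -/
structure ComposablePair (X : Type u) [Groupoid.{u} X] : Type u where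
  (src mid tgt : X)
  left : mid ⟶ tgt
  right : src ⟶ mid

/-- The inclusion of `𝒢⁽²⁾` in `𝒢 × 𝒢`. -/
def ComposablePair.toProd {X : Type u} [Groupoid.{u} X] (p : ComposablePair X) : Arr X × Arr X :=
  (⟨p.mid, p.tgt, p.left⟩, ⟨p.src, p.mid, p.right⟩)

/-- The product `g h` of a composable pair `(g, h)`. -/
def ComposablePair.mul {X : Type u} [Groupoid.{u} X] (p : ComposablePair X) : Arr X :=
  ⟨p.src, p.tgt, p.right ≫ p.left⟩

/-- `𝒢⁽²⁾` has the relative product topology. -/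
instance ComposablePair.instTopologicalSpace {X : Type u} [Groupoid.{u} X]
    [TopologicalSpace (Arr X)] : TopologicalSpace (ComposablePair X) :=
  TopologicalSpace.induced ComposablePair.toProd inferInstance

/-- A topological groupoid: inversion and composition are continuous, and the unit space `X` has
the topology that it inherits as a subspace of `𝒢`, each object being identified with its
identity arrow. -/
class TopologicalGroupoid (X : Type u) [Groupoid.{u} X] [TopologicalSpace X]
    [TopologicalSpace (Arr X)] : Prop where
  isInducing_unit : IsInducing (unitArr : X → Arr X)
  continuous_inverse : Continuous (Arr.inverse : Arr X → Arr X)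
  continuous_mul : Continuous (ComposablePair.mul : ComposablePair X → Arr X)

/-- An étale groupoid: the domain map is a local homeomorphism. -/
class EtaleGroupoid (X : Type u) [Groupoid.{u} X] [TopologicalSpace X]
    [TopologicalSpace (Arr X)] : Prop extends TopologicalGroupoid X where
  isLocalHomeomorph_dom : IsLocalHomeomorph (Arr.dom : Arr X → X)

/-- `B` is a compact open bisection of an étale groupoid. -/
structure IsCompactOpenBisection {X : Type u} [Groupoid.{u} X] [TopologicalSpace (Arr X)]
    (B : Set (Arr X)) : Prop where
  isCompact : IsCompact B
  isOpen : IsOpen B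
  injOn_dom : Set.InjOn Arr.dom B
  injOn_cod : Set.InjOn Arr.cod B

/-- An ample groupoid: an étale groupoid with Hausdorff unit space whose topology has a basis of
compact open bisections. -/
class AmpleGroupoid (X : Type u) [Groupoid.{u} X] [TopologicalSpace X]
    [TopologicalSpace (Arr X)] : Prop extends EtaleGroupoid X where
  t2Space : T2Space X
  isTopologicalBasis : IsTopologicalBasis {B : Set (Arr X) | IsCompactOpenBisection B}

/-! ### Graded groupoids -/

/-- A `Γ`-grading of a topological groupoid: a continuous functor `κ` from it to the discrete
group `Γ`. -/
structure Grading (X : Type u) [Groupoid.{u} X] [TopologicalSpace (Arr X)]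
    (Γ : Type w) [Group Γ] where
  deg : ∀ {x y : X}, (x ⟶ y) → Γ
  deg_comp : ∀ {x y z : X} (h : x ⟶ y) (g : y ⟶ z), deg (h ≫ g) = deg g * deg h
  isLocallyConstant : IsLocallyConstant fun g : Arr X => deg g.hom

namespace Grading

variable {X : Type u} [Groupoid.{u} X] [TopologicalSpace (Arr X)] {Γ : Type w} [Group Γ]
  (κ : Grading X Γ)

/-- The `γ`-component `𝒢_γ`. -/
def component (γ : Γ) : Set (Arr X) := {g | κ.deg g.hom = γ}

/-- `𝒢` is strongly graded if `𝒢_γ 𝒢_δ = 𝒢_{γδ}` for all `γ` and `δ`. -/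
def IsStronglyGraded : Prop :=
  ∀ γ δ : Γ, {k : Arr X | ∃ p : ComposablePair X,
    p.toProd.1 ∈ κ.component γ ∧ p.toProd.2 ∈ κ.component δ ∧ p.mul = k} = κ.component (γ * δ)

theorem deg_id (x : X) : κ.deg (𝟙 x) = 1 := by
  have h := κ.deg_comp (𝟙 x) (𝟙 x)
  rw [Category.comp_id] at h
  exact (mul_eq_left.mp h.symm)

theorem deg_inv {x y : X} (g : x ⟶ y) : κ.deg (Groupoid.inv g) = (κ.deg g)⁻¹ := by
  have h := κ.deg_comp g (Groupoid.inv g)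
  rw [Groupoid.comp_inv, deg_id] at h
  exact eq_inv_of_mul_eq_one_left h.symm

/-- The objects of the subgroupoid `𝒢_ε` of all arrows of degree `ε`: a copy of `X`. -/
@[ext]
structure Eps (κ : Grading X Γ) : Type u where
  obj : X

/-- The groupoid structure of `𝒢_ε`: its arrows are those of degree `ε`. -/
instance instGroupoidEps : Groupoid.{u} κ.Eps where
  Hom x y := {g : x.obj ⟶ y.obj // κ.deg g = 1}
  id x := ⟨𝟙 x.obj, κ.deg_id x.obj⟩
  comp f g := ⟨f.1 ≫ g.1, by rw [deg_comp, f.2, g.2, one_mul]⟩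
  id_comp f := Subtype.ext (Category.id_comp f.1)
  comp_id f := Subtype.ext (Category.comp_id f.1)
  assoc f g h := Subtype.ext (Category.assoc f.1 g.1 h.1)
  inv f := ⟨Groupoid.inv f.1, by rw [deg_inv, f.2, inv_one]⟩
  inv_comp f := Subtype.ext (Groupoid.inv_comp f.1)
  comp_inv f := Subtype.ext (Groupoid.comp_inv f.1)

/-- An arrow of degree `ε`, as an arrow of `𝒢_ε`. -/
def epsHom {x y : X} (g : x ⟶ y) (hg : κ.deg g = 1) : (⟨x⟩ : κ.Eps) ⟶ ⟨y⟩ := ⟨g, hg⟩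

/-- The inclusion of `𝒢_ε` in `𝒢`. -/
def epsArr (g : Arr κ.Eps) : Arr X := ⟨g.dom.obj, g.cod.obj, g.hom.1⟩

/-- The unit space of `𝒢_ε` is that of `𝒢`. -/
instance instTopologicalSpaceEps [TopologicalSpace X] : TopologicalSpace κ.Eps :=
  TopologicalSpace.induced Eps.obj inferInstance

/-- `𝒢_ε` has the subspace topology. -/
instance instTopologicalSpaceArrEps : TopologicalSpace (Arr κ.Eps) :=
  TopologicalSpace.induced κ.epsArr inferInstance

end Grading

/-! ### Sheaves of modules -/

/-- The total space of a family of stalks. -/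
@[ext]
structure Total {X : Type u} (E : X → Type w) where
  base : X
  val : E base

/-- The fibre product of the total space with itself over `X`. -/
structure TotalPair {X : Type u} (E : X → Type w) where
  base : X
  (fst snd : E base)

/-- The inclusion of the fibre product in the product. -/
def TotalPair.toProd {X : Type u} {E : X → Type w} (p : TotalPair E) : Total E × Total E :=
  (⟨p.base, p.fst⟩, ⟨p.base, p.snd⟩)

instance TotalPair.instTopologicalSpace {X : Type u} {E : X → Type w}
    [TopologicalSpace (Total E)] : TopologicalSpace (TotalPair E) :=
  TopologicalSpace.induced TotalPair.toProd inferInstance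

/-- The fibre product of the total space (along the projection) and `𝒢` (along `𝐜`): the pairs
`(e, g)` with `p(e) = 𝐜(g)`. -/
structure ActPair {X : Type u} [Groupoid.{u} X] (E : X → Type w) where
  (dom cod : X)
  elt : E cod
  hom : dom ⟶ cod

/-- The inclusion of the fibre product in the product. -/
def ActPair.toProd {X : Type u} [Groupoid.{u} X] {E : X → Type w} (p : ActPair E) :
    Total E × Arr X :=
  (⟨p.cod, p.elt⟩, ⟨p.dom, p.cod, p.hom⟩)

instance ActPair.instTopologicalSpace {X : Type u} [Groupoid.{u} X] [TopologicalSpace (Arr X)]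
    {E : X → Type w} [TopologicalSpace (Total E)] : TopologicalSpace (ActPair E) :=
  TopologicalSpace.induced ActPair.toProd inferInstance

section Pairs

variable {X : Type u} {E : X → Type w} [TopologicalSpace (Total E)]

theorem TotalPair.continuous_fst :
    Continuous fun p : TotalPair E => (⟨p.base, p.fst⟩ : Total E) :=
  _root_.continuous_fst.comp (f := TotalPair.toProd) continuous_induced_dom

theorem TotalPair.continuous_snd :
    Continuous fun p : TotalPair E => (⟨p.base, p.snd⟩ : Total E) :=
  _root_.continuous_snd.comp (f := TotalPair.toProd) continuous_induced_dom

variable [Groupoid.{u} X] [TopologicalSpace (Arr X)]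

theorem ActPair.continuous_elt :
    Continuous fun p : ActPair E => (⟨p.cod, p.elt⟩ : Total E) :=
  _root_.continuous_fst.comp (f := ActPair.toProd) continuous_induced_dom

theorem ActPair.continuous_arr :
    Continuous fun p : ActPair E => (⟨p.dom, p.cod, p.hom⟩ : Arr X) :=
  _root_.continuous_snd.comp (f := ActPair.toProd) continuous_induced_dom

end Pairs

/-- A (right) `𝒢`-sheaf of `R`-modules: a sheaf space over the unit space `X` with `R`-modules as
stalks, such that the zero section, addition and multiplication by scalars (`R` being discrete)
are continuous, with a continuous right action of `𝒢` by `R`-linear maps.  `act g e` is `e g`. -/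
structure GSheaf (X : Type u) [Groupoid.{u} X] [TopologicalSpace X] [TopologicalSpace (Arr X)]
    (R : Type v) [CommRing R] where
  stalk : X → Type (max u v)
  [addCommGroup : ∀ x, AddCommGroup (stalk x)]
  [module : ∀ x, Module R (stalk x)]
  [topology : TopologicalSpace (Total stalk)]
  isLocalHomeomorph : IsLocalHomeomorph (Total.base : Total stalk → X)
  continuous_zero : Continuous fun x => (⟨x, 0⟩ : Total stalk)
  continuous_add : Continuous fun p : TotalPair stalk => (⟨p.base, p.fst + p.snd⟩ : Total stalk)
  continuous_smul : ∀ r : R, Continuous fun e : Total stalk => (⟨e.base, r • e.val⟩ : Total stalk)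
  act : ∀ {x y : X}, (x ⟶ y) → stalk y →ₗ[R] stalk x
  continuous_act : Continuous fun p : ActPair stalk => (⟨p.dom, act p.hom p.elt⟩ : Total stalk)
  act_id : ∀ (x : X) (e : stalk x), act (𝟙 x) e = e
  act_mul : ∀ {x y z : X} (h : x ⟶ y) (g : y ⟶ z) (e : stalk z),
    act h (act g e) = act (h ≫ g) e

attribute [instance] GSheaf.addCommGroup GSheaf.module GSheaf.topology

namespace GSheaf

variable {X : Type u} [Groupoid.{u} X] [TopologicalSpace X] [TopologicalSpace (Arr X)]
  {R : Type v} [CommRing R]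

/-- A morphism of `𝒢`-sheaves of `R`-modules: an equivariant continuous map over `X` that is
linear on stalks. -/
@[ext]
structure Hom (E F : GSheaf X R) where
  map : ∀ x, E.stalk x →ₗ[R] F.stalk x
  continuous_map : Continuous fun e : Total E.stalk => (⟨e.base, map e.base e.val⟩ : Total F.stalk)
  map_act : ∀ {x y : X} (g : x ⟶ y) (e : E.stalk y), map x (E.act g e) = F.act g (map y e)

/-- The category of `𝒢`-sheaves of `R`-modules. -/
instance instCategory : Category (GSheaf X R) where
  Hom := Hom
  id E := ⟨fun _ => LinearMap.id, continuous_id, fun _ _ => rfl⟩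
  comp φ ψ := ⟨fun x => ψ.map x ∘ₗ φ.map x, ψ.continuous_map.comp φ.continuous_map,
    fun g e => by simp [φ.map_act, ψ.map_act]⟩

end GSheaf

open scoped Classical in
/-- A graded `𝒢`-sheaf of `R`-modules. -/
structure GradedGSheaf {X : Type u} [Groupoid.{u} X] [TopologicalSpace X]
    [TopologicalSpace (Arr X)] {Γ : Type w} [Group Γ] (κ : Grading X Γ)
    (R : Type v) [CommRing R] extends GSheaf X R where
  comp : ∀ x : X, Γ → Submodule R (stalk x)
  isInternal : ∀ x, DirectSum.IsInternal (comp x)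
  isOpen_comp : ∀ γ : Γ, IsOpen {e : Total stalk | e.val ∈ comp e.base γ}
  act_mem : ∀ {x y : X} (g : x ⟶ y) (γ : Γ) (e : stalk y), e ∈ comp y γ →
    act g e ∈ comp x (γ * κ.deg g)

namespace GradedGSheaf

variable {X : Type u} [Groupoid.{u} X] [TopologicalSpace X] [TopologicalSpace (Arr X)]
  {Γ : Type w} [Group Γ] {κ : Grading X Γ} {R : Type v} [CommRing R]

/-- A graded morphism: a morphism of `𝒢`-sheaves of `R`-modules that preserves the homogeneous
components. -/
@[ext]
structure Hom (E F : GradedGSheaf κ R) extends GSheaf.Hom E.toGSheaf F.toGSheaf where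
  map_mem : ∀ (x : X) (γ : Γ) (e : E.stalk x), e ∈ E.comp x γ → map x e ∈ F.comp x γ

/-- The category of graded `𝒢`-sheaves of `R`-modules. -/
instance instCategory : Category (GradedGSheaf κ R) where
  Hom := Hom
  id E := ⟨𝟙 E.toGSheaf, fun _ _ _ h => h⟩
  comp φ ψ := ⟨@CategoryStruct.comp (GSheaf X R) _ _ _ _ φ.toHom ψ.toHom,
    fun x γ e h => ψ.map_mem x γ _ (φ.map_mem x γ e h)⟩

end GradedGSheaf

/-! ### The restriction functor -/

section Restriction

variable {X : Type u} [Groupoid.{u} X] [TopologicalSpace X] [TopologicalSpace (Arr X)]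
  {Γ : Type w} [Group Γ] {κ : Grading X Γ} {R : Type v} [CommRing R]

namespace GradedGSheaf

variable (E : GradedGSheaf κ R)

/-- The stalks of `E_ε`. -/
abbrev epsStalk (x : κ.Eps) : Type (max u v) := E.comp x.obj 1

/-- The inclusion of `E_ε` in `E`. -/
def epsIncl (e : Total E.epsStalk) : Total E.stalk := ⟨e.base.obj, e.val.1⟩

/-- `E_ε` has the subspace topology. -/
instance instTopologicalSpaceTotalEpsStalk : TopologicalSpace (Total E.epsStalk) :=
  TopologicalSpace.induced E.epsIncl inferInstance

theorem isInducing_epsIncl : IsInducing E.epsIncl := ⟨rfl⟩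

theorem isOpenEmbedding_epsIncl : IsOpenEmbedding E.epsIncl := by
  refine ⟨⟨E.isInducing_epsIncl, ?_⟩, ?_⟩
  · rintro ⟨⟨x⟩, e, he⟩ ⟨⟨y⟩, f, hf⟩ h
    simp only [epsIncl, Total.mk.injEq] at h
    obtain ⟨rfl, h⟩ := h
    obtain rfl := eq_of_heq h
    rfl
  · convert E.isOpen_comp 1
    ext ⟨x, e⟩
    constructor
    · rintro ⟨⟨⟨y⟩, f, hf⟩, h⟩
      rw [← h]
      exact hf
    · intro h
      exact ⟨⟨⟨x⟩, e, h⟩, rfl⟩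

theorem continuous_epsObj : Continuous (Grading.Eps.obj : κ.Eps → X) := continuous_induced_dom

theorem act_mem_eps {x y : κ.Eps} (g : x ⟶ y) {e : E.stalk y.obj} (he : e ∈ E.comp y.obj 1) :
    E.act g.1 e ∈ E.comp x.obj 1 := by
  simpa [g.2] using E.act_mem g.1 1 e he

/-- The `𝒢_ε`-sheaf of `R`-modules `E_ε`. -/
noncomputable def eps : GSheaf κ.Eps R where
  stalk := E.epsStalk
  isLocalHomeomorph := by
    let c : κ.Eps ≃ₜ X :=
      { toFun := Grading.Eps.obj
        invFun := Grading.Eps.mk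
        continuous_toFun := continuous_epsObj
        continuous_invFun := continuous_induced_rng.2 continuous_id }
    exact c.symm.isLocalHomeomorph.comp
      (E.isLocalHomeomorph.comp E.isOpenEmbedding_epsIncl.isLocalHomeomorph)
  continuous_zero := E.isInducing_epsIncl.continuous_iff.2
    (E.continuous_zero.comp continuous_epsObj)
  continuous_add := by
    refine E.isInducing_epsIncl.continuous_iff.2 ?_
    let f : TotalPair E.epsStalk → TotalPair E.stalk := fun p => ⟨p.base.obj, p.fst.1, p.snd.1⟩
    have hf : Continuous f := by
      refine continuous_induced_rng.2 (Continuous.prodMk ?_ ?_)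
      · exact E.isInducing_epsIncl.continuous.comp TotalPair.continuous_fst
      · exact E.isInducing_epsIncl.continuous.comp TotalPair.continuous_snd
    exact E.continuous_add.comp hf
  continuous_smul r := E.isInducing_epsIncl.continuous_iff.2
    ((E.continuous_smul r).comp E.isInducing_epsIncl.continuous)
  act g := (E.act g.1).restrict fun _ he => E.act_mem_eps g he
  continuous_act := by
    refine E.isInducing_epsIncl.continuous_iff.2 ?_
    let f : ActPair E.epsStalk → ActPair E.stalk :=
      fun p => ⟨p.dom.obj, p.cod.obj, p.elt.1, p.hom.1⟩
    have hf : Continuous f := by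
      refine continuous_induced_rng.2 (Continuous.prodMk ?_ ?_)
      · exact E.isInducing_epsIncl.continuous.comp ActPair.continuous_elt
      · exact (continuous_induced_dom (f := κ.epsArr)).comp ActPair.continuous_arr
    exact E.continuous_act.comp hf
  act_id x e := Subtype.ext (E.act_id x.obj e.1)
  act_mul h g e := Subtype.ext (E.act_mul h.1 g.1 e.1)

/-- The restriction `φ_ε` of a graded morphism `φ`. -/
noncomputable def epsMap {E F : GradedGSheaf κ R} (φ : Hom E F) : GSheaf.Hom E.eps F.eps where
  map x := (φ.map x.obj).restrict fun e he => φ.map_mem x.obj 1 e he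
  continuous_map := F.isInducing_epsIncl.continuous_iff.2
    (φ.continuous_map.comp E.isInducing_epsIncl.continuous)
  map_act g e := Subtype.ext (φ.map_act g.1 e.1)

end GradedGSheaf

/-- The restriction functor `ℐ`, `E ↦ E_ε`. -/
noncomputable def restrictionFunctor (κ : Grading X Γ) (R : Type v) [CommRing R] :
    GradedGSheaf κ R ⥤ GSheaf κ.Eps R where
  obj E := E.eps
  map φ := GradedGSheaf.epsMap φ
  map_id _ := rfl
  map_comp _ _ := rfl

end Restriction

/-! ### Topologies given by sections -/


section SectionTopology

variable {X : Type u} [TopologicalSpace X] {R : Type v} [CommRing R] {F : X → Type w}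
  [∀ x, AddCommGroup (F x)] [∀ x, Module R (F x)]

/-- The image of `U` under the section `σ`. -/
def sectionImage (σ : ∀ x, F x) (U : Set X) : Set (Total F) :=
  (fun x => (⟨x, σ x⟩ : Total F)) '' U

/-- The topology generated by the images of compact open sets under the sections in `S`. -/
abbrev sectionTopology (S : Submodule R (∀ x, F x)) : TopologicalSpace (Total F) :=
  TopologicalSpace.generateFrom
    {Z | ∃ σ ∈ S, ∃ U : Set X, IsCompact U ∧ IsOpen U ∧ Z = sectionImage σ U}

theorem mem_sectionImage {σ : ∀ x, F x} {U : Set X} {e : Total F} :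
    e ∈ sectionImage σ U ↔ e.base ∈ U ∧ e.val = σ e.base := by
  constructor
  · rintro ⟨x, hx, rfl⟩
    exact ⟨hx, rfl⟩
  · rcases e with ⟨x, e⟩
    rintro ⟨hx, h⟩
    exact ⟨x, hx, Total.ext rfl (heq_of_eq h.symm)⟩

/-- Every point lies on a section, and sections that agree at a point agree near it. -/
structure IsSheafFamily (S : Submodule R (∀ x, F x)) : Prop where
  basis : IsTopologicalBasis {U : Set X | IsCompact U ∧ IsOpen U}
  cover : ∀ (x : X) (e : F x), ∃ σ ∈ S, σ x = e
  eventually_zero : ∀ σ ∈ S, ∀ x, σ x = 0 → ∀ᶠ y in 𝓝 x, σ y = 0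

namespace IsSheafFamily

variable {S : Submodule R (∀ x, F x)}

theorem eventually_eq (hS : IsSheafFamily S) {σ τ : ∀ x, F x} (hσ : σ ∈ S) (hτ : τ ∈ S) {x : X} (h : σ x = τ x) :
    ∀ᶠ y in 𝓝 x, σ y = τ y := by
  filter_upwards [hS.eventually_zero (σ - τ) (S.sub_mem hσ hτ) x (sub_eq_zero.2 h)] with y hy
  exact sub_eq_zero.1 hy

theorem exists_nhd (hS : IsSheafFamily S) {p : X → Prop} {x : X} (h : ∀ᶠ y in 𝓝 x, p y) :
    ∃ U : Set X, IsCompact U ∧ IsOpen U ∧ x ∈ U ∧ ∀ y ∈ U, p y := by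
  obtain ⟨U, hU, hx, hp⟩ := hS.basis.mem_nhds_iff.1 h
  exact ⟨U, hU.1, hU.2, hx, hp⟩

variable [t : TopologicalSpace (Total F)]

theorem isOpen_sectionImage (ht : t = sectionTopology S)
    {σ : ∀ x, F x} (hσ : σ ∈ S) {U : Set X} (hc : IsCompact U)
    (hU : IsOpen U) : IsOpen (sectionImage σ U) := by
  subst ht
  exact TopologicalSpace.isOpen_generateFrom_of_mem ⟨σ, hσ, U, hc, hU, rfl⟩

theorem continuous_section (hS : IsSheafFamily S) (ht : t = sectionTopology S)
    {σ : ∀ x, F x} (hσ : σ ∈ S) :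
    Continuous fun x => (⟨x, σ x⟩ : Total F) := by
  subst ht
  refine continuous_generateFrom_iff.2 ?_
  rintro _ ⟨τ, hτ, U, -, hU, rfl⟩
  rw [isOpen_iff_mem_nhds]
  intro x hx
  have hx' := mem_sectionImage.1 hx
  filter_upwards [hU.mem_nhds hx'.1, hS.eventually_eq hσ hτ hx'.2] with y h1 h2
  exact mem_sectionImage.2 ⟨h1, h2⟩

theorem continuous_base (hS : IsSheafFamily S) (ht : t = sectionTopology S)
    : Continuous (Total.base : Total F → X) := by
  rw [hS.basis.continuous_iff]
  rintro V ⟨hVc, hV⟩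
  rw [isOpen_iff_mem_nhds]
  intro e he
  obtain ⟨σ, hσ, h⟩ := hS.cover e.base e.val
  filter_upwards [(isOpen_sectionImage ht hσ hVc hV).mem_nhds
    (mem_sectionImage.2 ⟨he, h.symm⟩)] with f hf
  exact (mem_sectionImage.1 hf).1

theorem eventually_val_eq (hS : IsSheafFamily S) (ht : t = sectionTopology S)
    {σ : ∀ x, F x} (hσ : σ ∈ S) {e : Total F} (h : e.val = σ e.base) :
    ∀ᶠ f in 𝓝 e, f.val = σ f.base := by
  obtain ⟨U, hc, hU, hx, -⟩ := hS.exists_nhd (p := fun _ => True) (x := e.base) (by simp)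
  filter_upwards [(isOpen_sectionImage ht hσ hc hU).mem_nhds (mem_sectionImage.2 ⟨hx, h⟩)]
    with f hf
  exact (mem_sectionImage.1 hf).2

theorem isLocalHomeomorph_base (hS : IsSheafFamily S) (ht : t = sectionTopology S)
    : IsLocalHomeomorph (Total.base : Total F → X) := by
  refine IsLocalHomeomorph.mk _ fun e => ?_
  obtain ⟨σ, hσ, h⟩ := hS.cover e.base e.val
  obtain ⟨U, hc, hU, hx, -⟩ := hS.exists_nhd (p := fun _ => True) (x := e.base) (by simp)
  refine ⟨
    { toFun := Total.base
      invFun := fun x => ⟨x, σ x⟩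
      source := sectionImage σ U
      target := U
      map_source' := fun f hf => (mem_sectionImage.1 hf).1
      map_target' := fun x hx => ⟨x, hx, rfl⟩
      left_inv' := fun f hf =>
        Total.ext rfl (heq_of_eq (mem_sectionImage.1 hf).2.symm)
      right_inv' := fun x _ => rfl
      open_source := isOpen_sectionImage ht hσ hc hU
      open_target := hU
      continuousOn_toFun := (hS.continuous_base ht).continuousOn
      continuousOn_invFun := (hS.continuous_section ht hσ).continuousOn }, ?_, ?_⟩
  · exact mem_sectionImage.2 ⟨hx, h.symm⟩
  · exact fun _ _ => rfl

theorem continuous_add (hS : IsSheafFamily S) (ht : t = sectionTopology S)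
    :
    Continuous fun p : TotalPair F => (⟨p.base, p.fst + p.snd⟩ : Total F) := by
  rw [continuous_iff_continuousAt]
  intro p
  obtain ⟨σ, hσ, h⟩ := hS.cover p.base p.fst
  obtain ⟨τ, hτ, h'⟩ := hS.cover p.base p.snd
  have h1 := (TotalPair.continuous_fst (E := F)).continuousAt.eventually
    (hS.eventually_val_eq ht hσ (e := ⟨p.base, p.fst⟩) h.symm)
  have h2 := (TotalPair.continuous_snd (E := F)).continuousAt.eventually
    (hS.eventually_val_eq ht hτ (e := ⟨p.base, p.snd⟩) h'.symm)
  have h3 : Continuous fun p : TotalPair F => (⟨p.base, (σ + τ) p.base⟩ : Total F) :=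
    (hS.continuous_section ht (S.add_mem hσ hτ)).comp
      ((hS.continuous_base ht).comp TotalPair.continuous_fst)
  refine h3.continuousAt.congr ?_
  filter_upwards [h1, h2] with q hq1 hq2
  simp [hq1, hq2]

theorem continuous_smul (hS : IsSheafFamily S) (ht : t = sectionTopology S)
    (r : R) :
    Continuous fun e : Total F => (⟨e.base, r • e.val⟩ : Total F) := by
  rw [continuous_iff_continuousAt]
  intro e
  obtain ⟨σ, hσ, h⟩ := hS.cover e.base e.val
  have h3 : Continuous fun e : Total F => (⟨e.base, (r • σ) e.base⟩ : Total F) :=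
    (hS.continuous_section ht (S.smul_mem r hσ)).comp (hS.continuous_base ht)
  refine h3.continuousAt.congr ?_
  filter_upwards [hS.eventually_val_eq ht hσ h.symm] with q hq
  simp [hq]

theorem continuous_zero (hS : IsSheafFamily S) (ht : t = sectionTopology S)
    : Continuous fun x => (⟨x, 0⟩ : Total F) :=
  hS.continuous_section ht S.zero_mem

end IsSheafFamily
end SectionTopology

/-! ### The stalks `E ⊗ 𝒢^x` -/

section Tensor

variable {X : Type u} [Groupoid.{u} X] [TopologicalSpace X] [TopologicalSpace (Arr X)]
  {Γ : Type w} [Group Γ] {κ : Grading X Γ} {R : Type v} [CommRing R]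

/-- The symbols `e ⊗ g` with `g ∈ 𝒢^x` and `p(e) = 𝐜(g)`. -/
abbrev TensorSymbol (E : GSheaf κ.Eps R) (x : X) : Type (max u v) :=
  Σ g : Out x, E.stalk ⟨g.cod⟩

/-- The relations between the symbols `e ⊗ g`: additivity and homogeneity in `e`, and
`eh ⊗ g = e ⊗ hg` for `h ∈ 𝒢_ε`. -/
def tensorRelations (E : GSheaf κ.Eps R) (x : X) : Set (TensorSymbol E x →₀ R) :=
  {t | ∃ (g : Out x) (e e' : E.stalk ⟨g.cod⟩), t =
    (Finsupp.single ⟨g, e⟩ 1 + Finsupp.single ⟨g, e'⟩ 1) - Finsupp.single ⟨g, e + e'⟩ 1} ∪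
  {t | ∃ (r : R) (g : Out x) (e : E.stalk ⟨g.cod⟩), t =
    Finsupp.single ⟨g, r • e⟩ 1 - r • Finsupp.single ⟨g, e⟩ 1} ∪
  {t | ∃ (y z : X) (g : x ⟶ y) (h : (⟨y⟩ : κ.Eps) ⟶ ⟨z⟩) (e : E.stalk ⟨z⟩), t =
    Finsupp.single ⟨⟨y, g⟩, E.act h e⟩ 1 - Finsupp.single ⟨⟨z, g ≫ h.1⟩, e⟩ 1}

/-- The `R`-module `E ⊗ 𝒢^x`, generated by the symbols `e ⊗ g` subject to the relations. -/
def TensorStalk (E : GSheaf κ.Eps R) (x : X) : Type (max u v) :=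
  (TensorSymbol E x →₀ R) ⧸ Submodule.span R (tensorRelations E x)

noncomputable instance TensorStalk.instAddCommGroup (E : GSheaf κ.Eps R) (x : X) :
    AddCommGroup (TensorStalk E x) :=
  inferInstanceAs (AddCommGroup ((TensorSymbol E x →₀ R) ⧸ Submodule.span R (tensorRelations E x)))

noncomputable instance TensorStalk.instModule (E : GSheaf κ.Eps R) (x : X) :
    Module R (TensorStalk E x) :=
  inferInstanceAs (Module R ((TensorSymbol E x →₀ R) ⧸ Submodule.span R (tensorRelations E x)))

namespace TensorStalk

variable {E : GSheaf κ.Eps R} {x : X}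

/-- The quotient map from the free module on the symbols `e ⊗ g`. -/
noncomputable def mk (E : GSheaf κ.Eps R) (x : X) : (TensorSymbol E x →₀ R) →ₗ[R] TensorStalk E x :=
  Submodule.mkQ (Submodule.span R (tensorRelations E x))

theorem mk_eq {a b : TensorSymbol E x →₀ R} (h : a - b ∈ tensorRelations E x) :
    mk E x a = mk E x b :=
  (Submodule.Quotient.eq (Submodule.span R (tensorRelations E x))).2 (Submodule.subset_span h)

theorem mk_surjective : Function.Surjective (mk E x) :=
  Submodule.mkQ_surjective (Submodule.span R (tensorRelations E x))

/-- The element `e ⊗ g`. -/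
noncomputable def tmul (g : Out x) : E.stalk ⟨g.cod⟩ →ₗ[R] TensorStalk E x where
  toFun e := mk E x (Finsupp.single ⟨g, e⟩ 1)
  map_add' e e' := by
    symm
    rw [← map_add]
    exact mk_eq (Or.inl (Or.inl ⟨g, e, e', rfl⟩))
  map_smul' r e := by
    rw [RingHom.id_apply, ← map_smul]
    exact mk_eq (Or.inl (Or.inr ⟨r, g, e, rfl⟩))

theorem tmul_act {y z : X} (g : x ⟶ y) (h : (⟨y⟩ : κ.Eps) ⟶ ⟨z⟩) (e : E.stalk ⟨z⟩) :
    tmul (E := E) ⟨y, g⟩ (E.act h e) = tmul ⟨z, g ≫ h.1⟩ e :=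
  mk_eq (Or.inr ⟨y, z, g, h, e, rfl⟩)

/-- The universal property of `E ⊗ 𝒢^x`. -/
noncomputable def lift {N : Type*} [AddCommGroup N] [Module R N]
    (f : ∀ g : Out x, E.stalk ⟨g.cod⟩ →ₗ[R] N)
    (hf : ∀ (y z : X) (g : x ⟶ y) (h : (⟨y⟩ : κ.Eps) ⟶ ⟨z⟩) (e : E.stalk ⟨z⟩),
      f ⟨y, g⟩ (E.act h e) = f ⟨z, g ≫ h.1⟩ e) :
    TensorStalk E x →ₗ[R] N :=
  Submodule.liftQ (Submodule.span R (tensorRelations E x)) (Finsupp.linearCombination R fun s : TensorSymbol E x => f s.1 s.2) <| by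
    rw [Submodule.span_le]
    rintro _ ((⟨g, e, e', rfl⟩ | ⟨r, g, e, rfl⟩) | ⟨y, z, g, h, e, rfl⟩)
    · simp
    · simp
    · simp [hf]

@[simp]
theorem lift_tmul {N : Type*} [AddCommGroup N] [Module R N]
    (f : ∀ g : Out x, E.stalk ⟨g.cod⟩ →ₗ[R] N)
    (hf : ∀ (y z : X) (g : x ⟶ y) (h : (⟨y⟩ : κ.Eps) ⟶ ⟨z⟩) (e : E.stalk ⟨z⟩),
      f ⟨y, g⟩ (E.act h e) = f ⟨z, g ≫ h.1⟩ e) (g : Out x) (e : E.stalk ⟨g.cod⟩) :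
    lift f hf (tmul g e) = f g e := by
  refine (Submodule.liftQ_apply (Submodule.span R (tensorRelations E x)) _ _).trans ?_
  simp

/-- Every element of `E ⊗ 𝒢^x` is a sum of elements `e ⊗ g`. -/
theorem exists_sum (t : TensorStalk E x) :
    ∃ l : List (TensorSymbol E x), t = (l.map fun s => tmul s.1 s.2).sum := by
  obtain ⟨t, rfl⟩ := mk_surjective t
  induction t using Finsupp.induction_linear with
  | zero => exact ⟨[], by simp⟩
  | add t t' h h' =>
    obtain ⟨l, hl⟩ := h
    obtain ⟨l', hl'⟩ := h'
    exact ⟨l ++ l', by rw [map_add, hl, hl', List.map_append, List.sum_append]⟩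
  | single s r =>
    refine ⟨[⟨s.1, r • s.2⟩], ?_⟩
    have h : Finsupp.single s r = r • Finsupp.single s (1 : R) := by
      rw [Finsupp.smul_single, smul_eq_mul, mul_one]
    simp only [List.map_cons, List.map_nil, List.sum_cons, List.sum_nil, add_zero, map_smul]
    rw [h, map_smul]
    rfl

theorem hom_ext {N : Type*} [AddCommGroup N] [Module R N] {f f' : TensorStalk E x →ₗ[R] N}
    (h : ∀ (g : Out x) (e : E.stalk ⟨g.cod⟩), f (tmul g e) = f' (tmul g e)) : f = f' := by
  refine LinearMap.ext fun t => ?_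
  obtain ⟨l, rfl⟩ := exists_sum t
  induction l with
  | nil => simp
  | cons s l ih => rw [List.map_cons, List.sum_cons, map_add, map_add, h, ih]

open scoped Classical in
/-- The projection of `E ⊗ 𝒢^x` to its `γ`-component. -/
noncomputable def proj (γ : Γ) : TensorStalk E x →ₗ[R] TensorStalk E x :=
  lift (fun g => if κ.deg g.hom = γ then tmul g else 0) <| by
    intro y z g h e
    have : κ.deg (g ≫ h.1) = κ.deg g := by rw [κ.deg_comp, h.2, one_mul]
    simp only [this]
    split_ifs
    · exact tmul_act g h e
    · rfl

open scoped Classical in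
theorem proj_tmul (γ : Γ) (g : Out x) (e : E.stalk ⟨g.cod⟩) :
    proj γ (tmul g e) = if κ.deg g.hom = γ then tmul g e else 0 := by
  rw [proj, lift_tmul]
  split_ifs <;> rfl

/-- The homogeneous component `E ⊗ 𝒢^x_γ`, spanned by the `e ⊗ g` with `g` of degree `γ`. -/
noncomputable def comp (E : GSheaf κ.Eps R) (x : X) (γ : Γ) : Submodule R (TensorStalk E x) :=
  Submodule.span R {t | ∃ (g : Out x) (e : E.stalk ⟨g.cod⟩), κ.deg g.hom = γ ∧ t = tmul g e}

theorem proj_of_mem {γ : Γ} {t : TensorStalk E x} (ht : t ∈ comp E x γ) : proj γ t = t := by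
  induction ht using Submodule.span_induction with
  | mem t h =>
    obtain ⟨g, e, hg, rfl⟩ := h
    rw [proj_tmul, if_pos hg]
  | zero => simp
  | add s t _ _ hs ht => rw [map_add, hs, ht]
  | smul r t _ ht => rw [map_smul, ht]

theorem proj_of_mem_of_ne {γ δ : Γ} (h : δ ≠ γ) {t : TensorStalk E x} (ht : t ∈ comp E x δ) :
    proj γ t = 0 := by
  induction ht using Submodule.span_induction with
  | mem t h' =>
    obtain ⟨g, e, hg, rfl⟩ := h'
    rw [proj_tmul, if_neg (hg ▸ h)]
  | zero => simp
  | add s t _ _ hs ht => rw [map_add, hs, ht, add_zero]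
  | smul r t _ ht => rw [map_smul, ht, smul_zero]

theorem proj_mem (γ : Γ) (t : TensorStalk E x) : proj γ t ∈ comp E x γ := by
  obtain ⟨l, rfl⟩ := exists_sum t
  induction l with
  | nil => simp
  | cons s l ih =>
    rw [List.map_cons, List.sum_cons, map_add, proj_tmul]
    refine add_mem ?_ ih
    split_ifs with h
    · exact Submodule.subset_span ⟨s.1, s.2, h, rfl⟩
    · exact zero_mem _

open scoped Classical in
theorem isInternal_comp : DirectSum.IsInternal (comp E x) := by
  rw [DirectSum.isInternal_submodule_iff_iSupIndep_and_iSup_eq_top]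
  constructor
  · rw [iSupIndep_def]
    intro γ
    rw [Submodule.disjoint_def]
    intro t ht ht'
    have h : (⨆ δ, ⨆ (_ : δ ≠ γ), comp E x δ) ≤ LinearMap.ker (proj (E := E) (x := x) γ) :=
      iSup₂_le fun δ hδ s hs => proj_of_mem_of_ne hδ hs
    rw [← proj_of_mem ht]
    exact h ht'
  · rw [eq_top_iff]
    rintro t -
    obtain ⟨l, rfl⟩ := exists_sum t
    refine list_sum_mem ?_
    intro s hs
    obtain ⟨p, -, rfl⟩ := List.mem_map.1 hs
    exact Submodule.mem_iSup_of_mem (κ.deg p.1.hom) (Submodule.subset_span ⟨p.1, p.2, rfl, rfl⟩)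

theorem deg_inv_comp (h g : Out x) (hd : κ.deg g.hom = κ.deg h.hom) :
    κ.deg (Groupoid.inv h.hom ≫ g.hom) = 1 := by
  rw [κ.deg_comp, κ.deg_inv, hd, mul_inv_cancel]

open scoped Classical in
/-- The map `e ⊗ g ↦ e (g h⁻¹)` on the component of `E ⊗ 𝒢^x` of the degree of `h`, extended
by zero to the other components. -/
noncomputable def transport (h : Out x) : TensorStalk E x →ₗ[R] E.stalk ⟨h.cod⟩ :=
  lift (fun g => if hd : κ.deg g.hom = κ.deg h.hom then
      E.act (κ.epsHom (Groupoid.inv h.hom ≫ g.hom) (deg_inv_comp h g hd)) else 0) <| by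
    intro y z g k e
    have hk : κ.deg (g ≫ k.1) = κ.deg g := by rw [κ.deg_comp, k.2, one_mul]
    by_cases hd : κ.deg g = κ.deg h.hom
    · rw [dif_pos hd, dif_pos (hk.trans hd), E.act_mul]
      congr 1
      congr 1
      exact Subtype.ext (Category.assoc _ _ _)
    · rw [dif_neg hd, dif_neg (hk ▸ hd)]
      rfl

open scoped Classical in
theorem transport_tmul (h g : Out x) (e : E.stalk ⟨g.cod⟩) :
    transport h (tmul g e) = if hd : κ.deg g.hom = κ.deg h.hom then
      E.act (κ.epsHom (Groupoid.inv h.hom ≫ g.hom) (deg_inv_comp h g hd)) e else 0 := by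
  rw [transport, lift_tmul]
  split_ifs <;> rfl

theorem tmul_transport (h : Out x) (t : TensorStalk E x) :
    tmul h (transport h t) = proj (κ.deg h.hom) t := by
  refine LinearMap.congr_fun (f := tmul h ∘ₗ transport h) (hom_ext ?_) t
  intro g e
  rw [LinearMap.comp_apply, transport_tmul, proj_tmul]
  split_ifs with hd
  · rcases h with ⟨y, h⟩
    rcases g with ⟨z, g⟩
    rw [tmul_act]
    refine congrArg (fun k : x ⟶ z => tmul (E := E) ⟨z, k⟩ e) ?_
    simp [Grading.epsHom]
  · simp

theorem eq_zero_of_transport (l : List (TensorSymbol E x))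
    (h : ∀ p ∈ l, transport p.1 (l.map fun s => tmul s.1 s.2).sum = 0) :
    (l.map fun s => tmul (E := E) s.1 s.2).sum = 0 := by
  classical
  have key : ∀ (m : List (TensorSymbol E x)) (A : Finset Γ), (∀ p ∈ m, κ.deg p.1.hom ∈ A) →
      ∑ γ ∈ A, proj γ (m.map fun s => tmul (E := E) s.1 s.2).sum =
        (m.map fun s => tmul (E := E) s.1 s.2).sum := by
    intro m A
    induction m with
    | nil => simp
    | cons s m ih =>
      intro hA
      simp only [List.map_cons, List.sum_cons, map_add, Finset.sum_add_distrib]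
      rw [ih fun p hp => hA p (List.mem_cons_of_mem _ hp)]
      congr 1
      simp only [proj_tmul]
      rw [Finset.sum_ite_eq, if_pos (hA s List.mem_cons_self)]
  rw [← key l (l.map fun p => κ.deg p.1.hom).toFinset
    (fun p hp => List.mem_toFinset.2 (List.mem_map.2 ⟨p, hp, rfl⟩))]
  refine Finset.sum_eq_zero fun γ hγ => ?_
  obtain ⟨p, hp, rfl⟩ := List.mem_map.1 (List.mem_toFinset.1 hγ)
  rw [← tmul_transport, h p hp, map_zero]

/-- Right multiplication by an arrow, `(e ⊗ g) k = e ⊗ g k`. -/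
noncomputable def act {x' : X} (k : x' ⟶ x) : TensorStalk E x →ₗ[R] TensorStalk E x' :=
  lift (fun g => tmul ⟨g.cod, k ≫ g.hom⟩) <| by
    intro y z g h e
    rw [tmul_act]
    exact congrArg (fun f : x' ⟶ z => tmul (E := E) ⟨z, f⟩ e) (Category.assoc _ _ _)

@[simp]
theorem act_tmul {x' : X} (k : x' ⟶ x) (g : Out x) (e : E.stalk ⟨g.cod⟩) :
    act k (tmul g e) = tmul ⟨g.cod, k ≫ g.hom⟩ e := by
  rw [act, lift_tmul]

/-- The map `φ ⊗ id`, `e ⊗ g ↦ φ(e) ⊗ g`. -/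
noncomputable def map {F : GSheaf κ.Eps R} (φ : E ⟶ F) (x : X) :
    TensorStalk E x →ₗ[R] TensorStalk F x :=
  lift (fun g => tmul g ∘ₗ φ.map ⟨g.cod⟩) <| by
    intro y z g h e
    simp only [LinearMap.comp_apply]
    rw [φ.map_act, tmul_act]

@[simp]
theorem map_tmul {F : GSheaf κ.Eps R} (φ : E ⟶ F) (g : Out x) (e : E.stalk ⟨g.cod⟩) :
    map φ x (tmul g e) = tmul g (φ.map ⟨g.cod⟩ e) := by
  rw [map, lift_tmul]
  rfl

end TensorStalk

end Tensor

/-! ### Local sections in ample groupoids -/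

section Local

variable {X : Type u} [Groupoid.{u} X] [TopologicalSpace X] [TopologicalSpace (Arr X)]

theorem Out.toArr_injective {x : X} : Function.Injective (Out.toArr : Out x → Arr X) := by
  rintro ⟨y, g⟩ ⟨z, h⟩ hgh
  simp only [Out.toArr, Arr.mk.injEq, true_and] at hgh
  obtain ⟨rfl, h⟩ := hgh
  obtain rfl := eq_of_heq h
  rfl

theorem continuous_dom [EtaleGroupoid X] : Continuous (Arr.dom : Arr X → X) :=
  (EtaleGroupoid.isLocalHomeomorph_dom (X := X)).continuous

theorem continuous_cod [EtaleGroupoid X] : Continuous (Arr.cod : Arr X → X) :=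
  continuous_dom.comp (TopologicalGroupoid.continuous_inverse (X := X))

theorem Out.eq_of_mem {B : Set (Arr X)} (hB : IsCompactOpenBisection B) {x : X} {g h : Out x}
    (hg : g.toArr ∈ B) (hh : h.toArr ∈ B) : g = h :=
  Out.toArr_injective (hB.injOn_dom hg hh rfl)

theorem exists_localSection [EtaleGroupoid X] {B : Set (Arr X)} (hB : IsCompactOpenBisection B)
    {x₀ : X} (g₀ : Out x₀) (hg₀ : g₀.toArr ∈ B) :
    ∃ b : ∀ x : X, Out x, b x₀ = g₀ ∧ ContinuousAt (fun x => (b x).toArr) x₀ ∧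
      ∀ᶠ x in 𝓝 x₀, (b x).toArr ∈ B := by
  classical
  let b : ∀ x : X, Out x := fun x =>
    if h : ∃ g : Out x, g.toArr ∈ B then h.choose else ⟨x, 𝟙 x⟩
  have hb : ∀ a ∈ B, (b a.dom).toArr = a := by
    intro a ha
    have h : ∃ g : Out a.dom, g.toArr ∈ B := ⟨⟨a.cod, a.hom⟩, ha⟩
    have : b a.dom = h.choose := dif_pos h
    rw [this]
    exact hB.injOn_dom h.choose_spec ha rfl
  have hb₀ : b x₀ = g₀ := Out.toArr_injective (hb _ hg₀)
  have key : ∀ N ∈ 𝓝 g₀.toArr, ∀ᶠ x in 𝓝 x₀, (b x).toArr ∈ N ∩ B := by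
    intro N hN
    have := (EtaleGroupoid.isLocalHomeomorph_dom (X := X)).isOpenMap.image_mem_nhds
      (Filter.inter_mem hN (hB.isOpen.mem_nhds hg₀))
    refine Filter.mem_of_superset this ?_
    rintro _ ⟨a, ha, rfl⟩
    change (b a.dom).toArr ∈ N ∩ B
    rw [hb a ha.2]
    exact ha
  refine ⟨b, hb₀, ?_, ?_⟩
  · intro N hN
    change N ∈ 𝓝 (b x₀).toArr at hN
    rw [hb₀] at hN
    exact (key N hN).mono fun x hx => hx.1
  · exact (key _ Filter.univ_mem).mono fun x hx => hx.2

theorem exists_bisection [AmpleGroupoid X] (g : Arr X) {N : Set (Arr X)} (hN : N ∈ 𝓝 g) :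
    ∃ B, IsCompactOpenBisection B ∧ g ∈ B ∧ B ⊆ N := by
  obtain ⟨B, hB, h⟩ := (AmpleGroupoid.isTopologicalBasis (X := X)).mem_nhds_iff.1 hN
  exact ⟨B, hB, h⟩

theorem isTopologicalBasis_units [AmpleGroupoid X] :
    IsTopologicalBasis {U : Set X | IsCompact U ∧ IsOpen U} := by
  refine isTopologicalBasis_of_isOpen_of_nhds (fun U hU => hU.2) fun x V hx hV => ?_
  obtain ⟨B, hB, hxB, hBV⟩ := exists_bisection (unitArr x)
    ((hV.preimage continuous_dom).mem_nhds hx)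
  refine ⟨Arr.dom '' B, ⟨hB.isCompact.image continuous_dom, ?_⟩, ⟨_, hxB, rfl⟩, ?_⟩
  · exact (EtaleGroupoid.isLocalHomeomorph_dom (X := X)).isOpenMap _ hB.isOpen
  · rintro _ ⟨a, ha, rfl⟩
    exact hBV ha

theorem continuousAt_comp [EtaleGroupoid X] {Y : Type*} [TopologicalSpace Y] {y₀ : Y}
    {p : Y → ComposablePair X} (h₁ : ContinuousAt (fun y => (p y).toProd.1) y₀)
    (h₂ : ContinuousAt (fun y => (p y).toProd.2) y₀) :
    ContinuousAt (fun y => (p y).mul) y₀ := by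
  have hp : ContinuousAt p y₀ := by
    rw [(⟨rfl⟩ : IsInducing (ComposablePair.toProd : ComposablePair X → _)).continuousAt_iff]
    exact h₁.prodMk h₂
  exact (TopologicalGroupoid.continuous_mul (X := X)).continuousAt.comp hp

variable {R : Type v} [CommRing R]

/-- Compactly supported continuous sections. -/
structure IsCompactSection (E : GSheaf X R) (s : ∀ x, E.stalk x) : Prop where
  continuous : Continuous fun x => (⟨x, s x⟩ : Total E.stalk)
  isCompact_support : IsCompact {x | s x ≠ 0}

namespace GSheaf

variable (E : GSheaf X R)

theorem isOpen_zero : IsOpen {e : Total E.stalk | e.val = 0} := by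
  have h : IsLocalHomeomorph fun x => (⟨x, 0⟩ : Total E.stalk) :=
    IsLocalHomeomorph.of_comp (g := (Total.base : Total E.stalk → X))
      (Homeomorph.refl X).isLocalHomeomorph E.isLocalHomeomorph E.continuous_zero
  convert h.isOpenMap.isOpen_range
  ext ⟨x, e⟩
  constructor
  · rintro (rfl : e = 0)
    exact ⟨x, rfl⟩
  · rintro ⟨y, hy⟩
    rw [← hy]
    rfl

theorem isClosed_support {s : ∀ x, E.stalk x}
    (hs : Continuous fun x => (⟨x, s x⟩ : Total E.stalk)) : IsClosed {x | s x ≠ 0} :=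
  ⟨by
    convert E.isOpen_zero.preimage hs
    ext x
    simp⟩

theorem exists_compactSection [T2Space X]
    (hX : IsTopologicalBasis {U : Set X | IsCompact U ∧ IsOpen U}) {x₀ : X} (e : E.stalk x₀) :
    ∃ s : ∀ x, E.stalk x, IsCompactSection E s ∧ s x₀ = e := by
  classical
  obtain ⟨φ, he, hφ⟩ := E.isLocalHomeomorph ⟨x₀, e⟩
  have hx₀ : x₀ ∈ φ.target := by
    have := φ.map_source he
    rwa [← hφ] at this
  obtain ⟨W, ⟨hWc, hW⟩, hxW, hWV⟩ := hX.mem_nhds_iff.1 (φ.open_target.mem_nhds hx₀)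
  have hex : ∀ x : X, ∃ v : E.stalk x, x ∈ W → (⟨x, v⟩ : Total E.stalk) = φ.symm x := by
    intro x
    by_cases hx : x ∈ W
    · have h : (φ.symm x).base = x := by
        have := φ.right_inv (hWV hx)
        rwa [← hφ] at this
      generalize φ.symm x = f at h
      obtain ⟨y, v⟩ := f
      obtain rfl : y = x := h
      exact ⟨v, fun _ => rfl⟩
    · exact ⟨0, fun h => absurd h hx⟩
  choose v hv using hex
  let s : ∀ x, E.stalk x := fun x => if x ∈ W then v x else 0
  have hs : Continuous fun x => (⟨x, s x⟩ : Total E.stalk) := by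
    rw [continuous_iff_continuousAt]
    intro x
    by_cases hx : x ∈ W
    · refine (φ.continuousAt_symm (hWV hx)).congr ?_
      filter_upwards [hW.mem_nhds hx] with y hy
      simp only [s, if_pos hy]
      exact (hv y hy).symm
    · refine E.continuous_zero.continuousAt.congr ?_
      filter_upwards [hWc.isClosed.isOpen_compl.mem_nhds hx] with y hy
      simp only [s, if_neg hy]
  refine ⟨s, ⟨hs, ?_⟩, ?_⟩
  · refine hWc.of_isClosed_subset (E.isClosed_support hs) fun x hx => ?_
    by_contra h
    exact hx (if_neg h)
  · have h := hv x₀ hxW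
    have h' : φ.symm x₀ = ⟨x₀, e⟩ := by
      have := φ.left_inv he
      rwa [← hφ] at this
    rw [h'] at h
    simp only [s, if_pos hxW]
    simpa using h

theorem continuousAt_add {Y : Type*} [TopologicalSpace Y] {y₀ : Y} {f : Y → X}
    {s t : ∀ y, E.stalk (f y)} (hs : ContinuousAt (fun y => (⟨f y, s y⟩ : Total E.stalk)) y₀)
    (ht : ContinuousAt (fun y => (⟨f y, t y⟩ : Total E.stalk)) y₀) :
    ContinuousAt (fun y => (⟨f y, s y + t y⟩ : Total E.stalk)) y₀ := by
  let p : Y → TotalPair E.stalk := fun y => ⟨f y, s y, t y⟩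
  have hp : ContinuousAt p y₀ := by
    rw [(⟨rfl⟩ : IsInducing (TotalPair.toProd : TotalPair E.stalk → _)).continuousAt_iff]
    exact hs.prodMk ht
  exact E.continuous_add.continuousAt.comp hp

theorem continuousAt_act {Y : Type*} [TopologicalSpace Y] {y₀ : Y} {p : Y → ActPair E.stalk}
    (h₁ : ContinuousAt (fun y => (p y).toProd.1) y₀)
    (h₂ : ContinuousAt (fun y => (p y).toProd.2) y₀) :
    ContinuousAt
      (fun y => (⟨(p y).dom, E.act (p y).hom (p y).elt⟩ : Total E.stalk)) y₀ := by
  have hp : ContinuousAt p y₀ := by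
    rw [(⟨rfl⟩ : IsInducing (ActPair.toProd : ActPair E.stalk → _)).continuousAt_iff]
    exact h₁.prodMk h₂
  exact E.continuous_act.continuousAt.comp hp

end GSheaf

end Local

/-! ### The topology of `E ⊗ 𝒢` -/

section Induction

variable {X : Type u} [Groupoid.{u} X] [TopologicalSpace X] [TopologicalSpace (Arr X)]
  {Γ : Type w} [Group Γ] {κ : Grading X Γ} {R : Type v} [CommRing R]

/-- The homeomorphism between the unit spaces of `𝒢_ε` and `𝒢`. -/
def epsHomeomorph (κ : Grading X Γ) : κ.Eps ≃ₜ X where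
  toFun := Grading.Eps.obj
  invFun := Grading.Eps.mk
  continuous_toFun := continuous_induced_dom
  continuous_invFun := continuous_induced_rng.2 continuous_id

variable (X R) in
/-- The underlying `R`-module of the Steinberg algebra `A_R(𝒢)`: the span, in `R^𝒢`, of the
characteristic functions of the compact open bisections. -/
def steinberg : Submodule R (Arr X → R) :=
  Submodule.span R {f | ∃ B : Set (Arr X), IsCompactOpenBisection B ∧ f = B.indicator 1}

/-- The section `x ↦ ∑_{g ∈ 𝒢^x} f(g) s(𝐜(g)) ⊗ g` of `E ⊗ 𝒢`. -/
noncomputable def tensorSection (E : GSheaf κ.Eps R) (s : ∀ y, E.stalk y) (f : Arr X → R) (x : X) :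
    TensorStalk E x :=
  ∑ᶠ g : Out x, TensorStalk.tmul g (f g.toArr • s ⟨g.cod⟩)

/-- The finite sums of sections `x ↦ ∑_{g ∈ 𝒢^x} f(g) s(𝐜(g)) ⊗ g` with `s` a compactly supported
continuous section of `E` and `f ∈ A_R(𝒢)`. -/
noncomputable def tensorSections (E : GSheaf κ.Eps R) : Submodule R (∀ x, TensorStalk E x) :=
  Submodule.span R {σ | ∃ s f, IsCompactSection E s ∧ f ∈ steinberg X R ∧
    σ = tensorSection E s f}

/-- The topology of `E ⊗ 𝒢`: it is generated by the sets
`{∑_i ∑_{g ∈ 𝒢^x} f_i(g) s_i(𝐜(g)) ⊗ g | x ∈ U}`, where `U ⊆ X` is compact and open, the `s_i` are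
compactly supported continuous sections of `E`, and the `f_i` lie in `A_R(𝒢)`. -/
noncomputable instance instTopologicalSpaceTensor (E : GSheaf κ.Eps R) :
    TopologicalSpace (Total (TensorStalk E)) :=
  sectionTopology (tensorSections E)

namespace TensorStalk

variable {E : GSheaf κ.Eps R}

/-- A finite sum of elements `s(𝐜(b(x))) ⊗ b(x)`. -/
noncomputable def form (l : List ((∀ x : X, Out x) × (∀ y, E.stalk y))) (x : X) :
    TensorStalk E x :=
  (l.map fun p => tmul (p.1 x) (p.2 ⟨(p.1 x).cod⟩)).sum

/-- The continuity required of the data of a finite sum near a point. -/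
structure Good (x₀ : X) (p : (∀ x : X, Out x) × (∀ y, E.stalk y)) : Prop where
  fst : ContinuousAt (fun x => (p.1 x).toArr) x₀
  snd : Continuous fun y => (⟨y, p.2 y⟩ : Total E.stalk)

/-- A section that is locally a finite sum of continuous elementary sections. -/
def HasForm (σ : ∀ x, TensorStalk E x) (x₀ : X) : Prop :=
  ∃ l : List ((∀ x : X, Out x) × (∀ y, E.stalk y)), (∀ p ∈ l, Good x₀ p) ∧
    ∀ᶠ x in 𝓝 x₀, σ x = form l x

variable [EtaleGroupoid X]

theorem Good.continuousAt_cod {x₀ : X} {p : (∀ x : X, Out x) × (∀ y, E.stalk y)}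
    (hp : Good x₀ p) : ContinuousAt (fun x => (p.1 x).cod) x₀ :=
  (continuous_cod (X := X)).continuousAt.comp hp.fst

theorem Good.eventually_deg {x₀ : X} {p : (∀ x : X, Out x) × (∀ y, E.stalk y)}
    (hp : Good x₀ p) : ∀ᶠ x in 𝓝 x₀, κ.deg (p.1 x).hom = κ.deg (p.1 x₀).hom :=
  hp.fst.eventually (κ.isLocallyConstant.eventually_eq (p.1 x₀).toArr)

theorem Good.continuousAt_eps {x₀ : X} {p : (∀ x : X, Out x) × (∀ y, E.stalk y)}
    (hp : Good x₀ p) : ContinuousAt (fun x => (⟨(p.1 x).cod⟩ : κ.Eps)) x₀ :=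
  (epsHomeomorph κ).symm.continuous.continuousAt.comp hp.continuousAt_cod

theorem Good.continuousAt_val {x₀ : X} {p : (∀ x : X, Out x) × (∀ y, E.stalk y)}
    (hp : Good x₀ p) :
    ContinuousAt (fun x => (⟨⟨(p.1 x).cod⟩, p.2 ⟨(p.1 x).cod⟩⟩ : Total E.stalk)) x₀ :=
  hp.snd.continuousAt.comp hp.continuousAt_eps

theorem continuousAt_transport {x₀ : X} {p q : (∀ x : X, Out x) × (∀ y, E.stalk y)}
    (hp : Good x₀ p) (hq : Good x₀ q) :
    ContinuousAt (fun x => (⟨⟨(q.1 x).cod⟩,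
      transport (q.1 x) (tmul (p.1 x) (p.2 ⟨(p.1 x).cod⟩))⟩ : Total E.stalk)) x₀ := by
  classical
  by_cases hd : κ.deg (p.1 x₀).hom = κ.deg (q.1 x₀).hom
  · have hev : ∀ᶠ x in 𝓝 x₀, κ.deg (p.1 x).hom = κ.deg (q.1 x).hom := by
      filter_upwards [hp.eventually_deg, hq.eventually_deg] with x h1 h2
      rw [h1, h2, hd]
    let a : X → ActPair E.stalk := fun x =>
      if h : κ.deg (p.1 x).hom = κ.deg (q.1 x).hom then
        ⟨⟨(q.1 x).cod⟩, ⟨(p.1 x).cod⟩, p.2 ⟨(p.1 x).cod⟩,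
          κ.epsHom (Groupoid.inv (q.1 x).hom ≫ (p.1 x).hom) (deg_inv_comp (q.1 x) (p.1 x) h)⟩
      else ⟨⟨(q.1 x).cod⟩, ⟨(q.1 x).cod⟩, 0, 𝟙 _⟩
    have hpos : ∀ (x : X) (h : κ.deg (p.1 x).hom = κ.deg (q.1 x).hom), a x =
        ⟨⟨(q.1 x).cod⟩, ⟨(p.1 x).cod⟩, p.2 ⟨(p.1 x).cod⟩,
          κ.epsHom (Groupoid.inv (q.1 x).hom ≫ (p.1 x).hom) (deg_inv_comp (q.1 x) (p.1 x) h)⟩ :=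
      fun x h => dif_pos h
    have hneg : ∀ (x : X), ¬ κ.deg (p.1 x).hom = κ.deg (q.1 x).hom → a x =
        ⟨⟨(q.1 x).cod⟩, ⟨(q.1 x).cod⟩, 0, 𝟙 _⟩ :=
      fun x h => dif_neg h
    have ha1 : ContinuousAt (fun x => (a x).toProd.1) x₀ := by
      refine hp.continuousAt_val.congr ?_
      filter_upwards [hev] with x hx
      rw [hpos x hx]
      rfl
    have ha2 : ContinuousAt (fun x => (a x).toProd.2) x₀ := by
      rw [(⟨rfl⟩ : IsInducing κ.epsArr).continuousAt_iff]
      let c : X → ComposablePair X := fun x =>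
        ⟨(q.1 x).cod, x, (p.1 x).cod, (p.1 x).hom, Groupoid.inv (q.1 x).hom⟩
      have hc : ContinuousAt (fun x => (c x).mul) x₀ := by
        refine continuousAt_comp hp.fst ?_
        exact (TopologicalGroupoid.continuous_inverse (X := X)).continuousAt.comp hq.fst
      refine hc.congr ?_
      filter_upwards [hev] with x hx
      rw [Function.comp_apply, hpos x hx]
      rfl
    refine (E.continuousAt_act ha1 ha2).congr (Filter.Eventually.of_forall fun x => ?_)
    by_cases h : κ.deg (p.1 x).hom = κ.deg (q.1 x).hom
    · refine (congrArg (fun b : ActPair E.stalk =>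
        (⟨b.dom, E.act b.hom b.elt⟩ : Total E.stalk)) (hpos x h)).trans ?_
      beta_reduce
      rw [transport_tmul, dif_pos h]
    · refine (congrArg (fun b : ActPair E.stalk =>
        (⟨b.dom, E.act b.hom b.elt⟩ : Total E.stalk)) (hneg x h)).trans ?_
      beta_reduce
      rw [transport_tmul, dif_neg h, map_zero]
  · have h0 : ContinuousAt (fun x => (⟨⟨(q.1 x).cod⟩, 0⟩ : Total E.stalk)) x₀ :=
      E.continuous_zero.continuousAt.comp hq.continuousAt_eps
    refine h0.congr ?_
    filter_upwards [hp.eventually_deg, hq.eventually_deg] with x h1 h2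
    rw [transport_tmul, dif_neg]
    rwa [h1, h2]

theorem continuousAt_transport_form {x₀ : X} {q : (∀ x : X, Out x) × (∀ y, E.stalk y)}
    (hq : Good x₀ q) (l : List ((∀ x : X, Out x) × (∀ y, E.stalk y)))
    (hl : ∀ p ∈ l, Good x₀ p) :
    ContinuousAt (fun x => (⟨⟨(q.1 x).cod⟩, transport (q.1 x) (form l x)⟩ : Total E.stalk)) x₀ := by
  induction l with
  | nil =>
    simp only [form, List.map_nil, List.sum_nil, map_zero]
    exact E.continuous_zero.continuousAt.comp hq.continuousAt_eps
  | cons p l ih =>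
    simp only [form, List.map_cons, List.sum_cons, map_add]
    exact E.continuousAt_add (continuousAt_transport (hl p List.mem_cons_self) hq)
      (ih fun r hr => hl r (List.mem_cons_of_mem _ hr))

theorem eventually_form_eq_zero {x₀ : X} {l : List ((∀ x : X, Out x) × (∀ y, E.stalk y))}
    (hl : ∀ p ∈ l, Good x₀ p) (h : form l x₀ = 0) : ∀ᶠ x in 𝓝 x₀, form l x = 0 := by
  have key : ∀ᶠ x in 𝓝 x₀, ∀ q ∈ l, transport (q.1 x) (form l x) = 0 := by
    have : ∀ᶠ x in 𝓝 x₀, ∀ q ∈ {q | q ∈ l}, transport (q.1 x) (form l x) = 0 := by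
      refine (Filter.eventually_all_finite l.finite_toSet).2 fun q hq => ?_
      refine (continuousAt_transport_form (hl q hq) l hl).eventually
        (E.isOpen_zero.mem_nhds ?_)
      change transport (q.1 x₀) (form l x₀) = 0
      rw [h, map_zero]
    exact this
  filter_upwards [key] with x hx
  have h2 := eq_zero_of_transport (E := E) (x := x)
    (l.map fun p => ⟨p.1 x, p.2 ⟨(p.1 x).cod⟩⟩)
  rw [List.map_map] at h2
  refine h2 fun s hs => ?_
  obtain ⟨q, hq, rfl⟩ := List.mem_map.1 hs
  exact hx q hq

theorem HasForm.zero (x₀ : X) : HasForm (0 : ∀ x, TensorStalk E x) x₀ :=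
  ⟨[], by simp, Filter.Eventually.of_forall fun x => by simp [form]⟩

theorem HasForm.add {σ τ : ∀ x, TensorStalk E x} {x₀ : X} (hσ : HasForm σ x₀)
    (hτ : HasForm τ x₀) : HasForm (σ + τ) x₀ := by
  obtain ⟨l, hl, h⟩ := hσ
  obtain ⟨m, hm, h'⟩ := hτ
  refine ⟨l ++ m, fun p hp => (List.mem_append.1 hp).elim (hl p) (hm p), ?_⟩
  filter_upwards [h, h'] with x h1 h2
  simp only [form, List.map_append, List.sum_append, Pi.add_apply, h1, h2]

theorem HasForm.smul (r : R) {σ : ∀ x, TensorStalk E x} {x₀ : X} (hσ : HasForm σ x₀) :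
    HasForm (r • σ) x₀ := by
  obtain ⟨l, hl, h⟩ := hσ
  refine ⟨l.map fun p => (p.1, r • p.2), ?_, ?_⟩
  · intro p hp
    obtain ⟨q, hq, rfl⟩ := List.mem_map.1 hp
    exact ⟨(hl q hq).fst, (E.continuous_smul r).comp (hl q hq).snd⟩
  · filter_upwards [h] with x h1
    simp only [form, List.map_map, Function.comp_def, Pi.smul_apply, h1, map_smul,
      List.smul_sum]

theorem HasForm.congr {σ τ : ∀ x, TensorStalk E x} {x₀ : X} (hσ : HasForm σ x₀)
    (h : ∀ᶠ x in 𝓝 x₀, σ x = τ x) : HasForm τ x₀ := by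
  obtain ⟨l, hl, h'⟩ := hσ
  refine ⟨l, hl, ?_⟩
  filter_upwards [h, h'] with x h1 h2
  rw [← h1, h2]

theorem HasForm.eventually_zero {σ : ∀ x, TensorStalk E x} {x₀ : X} (hσ : HasForm σ x₀)
    (h : σ x₀ = 0) : ∀ᶠ x in 𝓝 x₀, σ x = 0 := by
  obtain ⟨l, hl, h'⟩ := hσ
  have h0 : form l x₀ = 0 := h'.self_of_nhds.symm.trans h
  filter_upwards [h', eventually_form_eq_zero hl h0] with x h1 h2
  rw [h1, h2]

theorem HasForm.eventually_eq {σ τ : ∀ x, TensorStalk E x} {x₀ : X} (hσ : HasForm σ x₀)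
    (hτ : HasForm τ x₀) (h : σ x₀ = τ x₀) : ∀ᶠ x in 𝓝 x₀, σ x = τ x := by
  have h1 := (hσ.add (hτ.smul (-1 : R))).eventually_zero (by simp [h])
  filter_upwards [h1] with x hx
  simpa [← sub_eq_add_neg, sub_eq_zero] using hx

/-- The pullback of a local form along a local section of `𝒢`. -/
theorem HasForm.act {σ : ∀ x, TensorStalk E x} {x₀ : X} {b : ∀ x : X, Out x}
    (hb : ContinuousAt (fun x => (b x).toArr) x₀) (hσ : HasForm σ (b x₀).cod) :
    HasForm (fun x => TensorStalk.act (b x).hom (σ (b x).cod)) x₀ := by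
  have hc : ContinuousAt (fun x => (b x).cod) x₀ :=
    (continuous_cod (X := X)).continuousAt.comp hb
  obtain ⟨l, hl, h⟩ := hσ
  refine ⟨l.map fun p =>
    (fun x => ⟨(p.1 (b x).cod).cod, (b x).hom ≫ (p.1 (b x).cod).hom⟩, p.2), ?_, ?_⟩
  · intro p hp
    obtain ⟨q, hq, rfl⟩ := List.mem_map.1 hp
    refine ⟨?_, (hl q hq).snd⟩
    let c : X → ComposablePair X := fun x =>
      ⟨x, (b x).cod, (q.1 (b x).cod).cod, (q.1 (b x).cod).hom, (b x).hom⟩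
    have h1 : ContinuousAt (fun x => (c x).toProd.1) x₀ :=
      ContinuousAt.comp (g := fun y => (q.1 y).toArr) (f := fun x => (b x).cod)
        (hl q hq).fst hc
    exact continuousAt_comp (p := c) h1 hb
  · filter_upwards [hc.eventually h] with x hx
    rw [hx]
    simp only [form, map_list_sum, List.map_map, Function.comp_def, act_tmul]

end TensorStalk

end Induction

section InductionFunctor

variable {X : Type u} [Groupoid.{u} X] [TopologicalSpace X] [TopologicalSpace (Arr X)]
  {Γ : Type w} [Group Γ] {κ : Grading X Γ} {R : Type v} [CommRing R]

theorem steinberg_finite {f : Arr X → R} (hf : f ∈ steinberg X R) (x : X) :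
    {g : Out x | f g.toArr ≠ 0}.Finite := by
  induction hf using Submodule.span_induction with
  | mem f h =>
    obtain ⟨B, hB, rfl⟩ := h
    refine Set.Subsingleton.finite fun g hg h hh => ?_
    exact Out.eq_of_mem hB (Set.mem_of_indicator_ne_zero hg) (Set.mem_of_indicator_ne_zero hh)
  | zero => simp
  | add f f' _ _ hf hf' =>
    refine (hf.union hf').subset fun g hg => ?_
    by_contra h
    simp only [Set.mem_union, Set.mem_ofPred_eq, not_or, not_not] at h
    exact hg (by simp [h.1, h.2])
  | smul r f _ hf =>
    refine hf.subset fun g hg h => ?_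
    exact hg (by simp [h])

namespace TensorStalk

variable {E : GSheaf κ.Eps R}

theorem tensorSection_finite (s : ∀ y, E.stalk y) {f : Arr X → R} (hf : f ∈ steinberg X R)
    (x : X) : (Function.support fun g : Out x => tmul g (f g.toArr • s ⟨g.cod⟩)).Finite := by
  refine (steinberg_finite hf x).subset fun g hg h => ?_
  exact hg (by simp [h])

theorem tensorSection_zero (s : ∀ y, E.stalk y) : tensorSection E s (0 : Arr X → R) = 0 := by
  funext x
  simp [tensorSection]

theorem tensorSection_add (s : ∀ y, E.stalk y) {f f' : Arr X → R} (hf : f ∈ steinberg X R)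
    (hf' : f' ∈ steinberg X R) :
    tensorSection E s (f + f') = tensorSection E s f + tensorSection E s f' := by
  funext x
  simp only [tensorSection, Pi.add_apply, add_smul, map_add]
  exact finsum_add_distrib (tensorSection_finite s hf x) (tensorSection_finite s hf' x)

theorem tensorSection_smul (s : ∀ y, E.stalk y) {f : Arr X → R} (hf : f ∈ steinberg X R) (r : R) :
    tensorSection E s (r • f) = r • tensorSection E s f := by
  funext x
  simp only [tensorSection, Pi.smul_apply, smul_eq_mul, mul_smul, map_smul]
  have h := smul_finsum' r (tensorSection_finite s hf x)
  simp only [map_smul] at h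
  exact h.symm

theorem tensorSection_indicator (s : ∀ y, E.stalk y) {B : Set (Arr X)}
    (hB : IsCompactOpenBisection B) {x : X} (g : Out x) (hg : g.toArr ∈ B) :
    tensorSection E s (B.indicator 1) x = tmul g (s ⟨g.cod⟩) := by
  rw [tensorSection, finsum_eq_single _ g]
  · simp [Set.indicator_of_mem hg]
  · intro h hh
    rw [Set.indicator_of_notMem fun hm => hh (Out.eq_of_mem hB hm hg), zero_smul, map_zero]

theorem tensorSection_indicator_zero (s : ∀ y, E.stalk y) {B : Set (Arr X)} {x : X}
    (hx : ¬ ∃ g : Out x, g.toArr ∈ B) : tensorSection E s (B.indicator 1) x = 0 := by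
  rw [tensorSection, ← finsum_zero (α := Out x)]
  refine finsum_congr fun g => ?_
  rw [Set.indicator_of_notMem fun hm => hx ⟨g, hm⟩, zero_smul, map_zero]

theorem act_mem_comp {x y : X} (g : x ⟶ y) {γ : Γ} {t : TensorStalk E y} (ht : t ∈ comp E y γ) :
    act g t ∈ comp E x (γ * κ.deg g) := by
  induction ht using Submodule.span_induction with
  | mem t h =>
    obtain ⟨k, e, hk, rfl⟩ := h
    rw [act_tmul]
    refine Submodule.subset_span ⟨⟨k.cod, g ≫ k.hom⟩, e, ?_, rfl⟩
    rw [κ.deg_comp, hk]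
  | zero => rw [map_zero]; exact zero_mem _
  | add s t _ _ hs ht => rw [map_add]; exact add_mem hs ht
  | smul r t _ ht => rw [map_smul]; exact Submodule.smul_mem _ r ht

theorem map_mem_comp {F : GSheaf κ.Eps R} (φ : E ⟶ F) {x : X} {γ : Γ} {t : TensorStalk E x}
    (ht : t ∈ comp E x γ) : map φ x t ∈ comp F x γ := by
  induction ht using Submodule.span_induction with
  | mem t h =>
    obtain ⟨k, e, hk, rfl⟩ := h
    rw [map_tmul]
    exact Submodule.subset_span ⟨k, _, hk, rfl⟩
  | zero => rw [map_zero]; exact zero_mem _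
  | add s t _ _ hs ht => rw [map_add]; exact add_mem hs ht
  | smul r t _ ht => rw [map_smul]; exact Submodule.smul_mem _ r ht

variable [AmpleGroupoid X]

theorem hasForm_indicator {s : ∀ y, E.stalk y}
    (hs : Continuous fun y => (⟨y, s y⟩ : Total E.stalk)) {B : Set (Arr X)}
    (hB : IsCompactOpenBisection B) (x₀ : X) :
    HasForm (tensorSection E s (B.indicator 1)) x₀ := by
  have : T2Space X := AmpleGroupoid.t2Space
  by_cases hx : ∃ g : Out x₀, g.toArr ∈ B
  · obtain ⟨g, hg⟩ := hx
    obtain ⟨b, -, hb, hbB⟩ := exists_localSection hB g hg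
    refine ⟨[(b, s)], ?_, ?_⟩
    · intro p hp
      rw [List.mem_singleton] at hp
      subst hp
      exact ⟨hb, hs⟩
    · filter_upwards [hbB] with x hx
      rw [tensorSection_indicator s hB (b x) hx]
      simp [form]
  · refine ⟨[], by simp, ?_⟩
    have hcl : IsClosed (Arr.dom '' B) := (hB.isCompact.image continuous_dom).isClosed
    have hx' : x₀ ∈ (Arr.dom '' B)ᶜ := by
      rintro ⟨a, ha, rfl⟩
      exact hx ⟨⟨a.cod, a.hom⟩, ha⟩
    filter_upwards [hcl.isOpen_compl.mem_nhds hx'] with x hx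
    rw [tensorSection_indicator_zero s]
    · simp [form]
    · rintro ⟨g, hg⟩
      exact hx ⟨_, hg, rfl⟩

theorem hasForm_tensorSection {s : ∀ y, E.stalk y}
    (hs : Continuous fun y => (⟨y, s y⟩ : Total E.stalk)) {f : Arr X → R}
    (hf : f ∈ steinberg X R) (x₀ : X) : HasForm (tensorSection E s f) x₀ := by
  induction hf using Submodule.span_induction with
  | mem f h =>
    obtain ⟨B, hB, rfl⟩ := h
    exact hasForm_indicator hs hB x₀
  | zero =>
    rw [tensorSection_zero]
    exact HasForm.zero x₀
  | add f f' hf hf' h h' =>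
    rw [tensorSection_add s hf hf']
    exact h.add h'
  | smul r f hf h =>
    rw [tensorSection_smul s hf]
    exact h.smul r

theorem hasForm_of_mem {σ : ∀ x, TensorStalk E x} (hσ : σ ∈ tensorSections E) (x₀ : X) :
    HasForm σ x₀ := by
  induction hσ using Submodule.span_induction with
  | mem σ h =>
    obtain ⟨s, f, hs, hf, rfl⟩ := h
    exact hasForm_tensorSection hs.continuous hf x₀
  | zero => exact HasForm.zero x₀
  | add σ τ _ _ h h' => exact h.add h'
  | smul r σ _ h => exact h.smul r

theorem exists_section_tmul {x : X} (g : Out x) (e : E.stalk ⟨g.cod⟩) :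
    ∃ σ ∈ tensorSections E, σ x = tmul g e ∧ ∀ x', σ x' ∈ comp E x' (κ.deg g.hom) := by
  have hT : T2Space X := AmpleGroupoid.t2Space
  have : T2Space κ.Eps := (epsHomeomorph κ).symm.t2Space
  have hb : IsTopologicalBasis {U : Set κ.Eps | IsCompact U ∧ IsOpen U} := by
    refine isTopologicalBasis_of_isOpen_of_nhds (fun U hU => hU.2) fun x V hx hV => ?_
    obtain ⟨U, hU, hxU, hUV⟩ := (isTopologicalBasis_units (X := X)).mem_nhds_iff.1
      (((epsHomeomorph κ).isOpenMap V hV).mem_nhds ⟨x, hx, rfl⟩)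
    refine ⟨epsHomeomorph κ ⁻¹' U, ⟨?_, hU.2.preimage (epsHomeomorph κ).continuous⟩, hxU, ?_⟩
    · exact (epsHomeomorph κ).isCompact_preimage.2 hU.1
    · intro y hy
      obtain ⟨z, hz, h⟩ := hUV hy
      rwa [← (epsHomeomorph κ).injective h]
  obtain ⟨s, hs, hse⟩ := E.exists_compactSection hb e
  obtain ⟨B, hB, hgB, hBd⟩ := exists_bisection g.toArr
    ((κ.isLocallyConstant.isOpen_fiber (κ.deg g.hom)).mem_nhds
      (rfl : κ.deg g.toArr.hom = κ.deg g.hom))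
  refine ⟨tensorSection E s (B.indicator 1), Submodule.subset_span
    ⟨s, _, hs, Submodule.subset_span ⟨B, hB, rfl⟩, rfl⟩, ?_, ?_⟩
  · rw [tensorSection_indicator s hB g hgB, hse]
  · intro x'
    by_cases hx : ∃ h : Out x', h.toArr ∈ B
    · obtain ⟨h, hh⟩ := hx
      rw [tensorSection_indicator s hB h hh]
      exact Submodule.subset_span ⟨h, _, hBd hh, rfl⟩
    · rw [tensorSection_indicator_zero s hx]
      exact zero_mem _

theorem isSheafFamily : IsSheafFamily (tensorSections E) where
  basis := isTopologicalBasis_units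
  cover x t := by
    obtain ⟨l, rfl⟩ := exists_sum t
    induction l with
    | nil => exact ⟨0, zero_mem _, by simp⟩
    | cons p l ih =>
      obtain ⟨σ, hσ, h⟩ := ih
      obtain ⟨τ, hτ, h', -⟩ := exists_section_tmul p.1 p.2
      exact ⟨τ + σ, add_mem hτ hσ, by simp [h, h']⟩
  eventually_zero _ hσ x₀ h := (hasForm_of_mem hσ x₀).eventually_zero h

theorem exists_section_comp {x : X} {γ : Γ} {t : TensorStalk E x} (ht : t ∈ comp E x γ) :
    ∃ σ ∈ tensorSections E, σ x = t ∧ ∀ x', σ x' ∈ comp E x' γ := by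
  induction ht using Submodule.span_induction with
  | mem t h =>
    obtain ⟨g, e, rfl, rfl⟩ := h
    exact exists_section_tmul g e
  | zero => exact ⟨0, zero_mem _, rfl, fun _ => zero_mem _⟩
  | add s t _ _ hs ht =>
    obtain ⟨σ, hσ, h, h1⟩ := hs
    obtain ⟨τ, hτ, h', h1'⟩ := ht
    exact ⟨σ + τ, add_mem hσ hτ, by simp [h, h'], fun x' => add_mem (h1 x') (h1' x')⟩
  | smul r t _ ht =>
    obtain ⟨σ, hσ, h, h1⟩ := ht
    exact ⟨r • σ, Submodule.smul_mem _ r hσ, by simp [h],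
      fun x' => Submodule.smul_mem _ r (h1 x')⟩

theorem continuous_act :
    Continuous fun p : ActPair (TensorStalk E) =>
      (⟨p.dom, act p.hom p.elt⟩ : Total (TensorStalk E)) := by
  rw [continuous_iff_continuousAt]
  rintro ⟨x₀, y₀, t₀, g₀⟩
  have hS := isSheafFamily (E := E)
  obtain ⟨σ, hσ, hσ₀⟩ := hS.cover y₀ t₀
  obtain ⟨τ, hτ, hτ₀⟩ := hS.cover x₀ (act g₀ t₀)
  obtain ⟨B, hB, hgB, -⟩ := exists_bisection (⟨x₀, y₀, g₀⟩ : Arr X) Filter.univ_mem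
  obtain ⟨b, hb₀, hb, hbB⟩ := exists_localSection hB (⟨y₀, g₀⟩ : Out x₀) hgB
  have h1 : HasForm (fun x => act (b x).hom (σ (b x).cod)) x₀ := by
    refine HasForm.act hb ?_
    exact hasForm_of_mem hσ _
  have h2 : ∀ᶠ x in 𝓝 x₀, τ x = act (b x).hom (σ (b x).cod) := by
    refine (hasForm_of_mem hτ x₀).eventually_eq h1 ?_
    rw [hb₀, hτ₀, hσ₀]
  have hdom : Continuous fun p : ActPair (TensorStalk E) => p.dom :=
    (continuous_dom (X := X)).comp ActPair.continuous_arr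
  have h3 : Continuous fun p : ActPair (TensorStalk E) =>
      (⟨p.dom, τ p.dom⟩ : Total (TensorStalk E)) :=
    (hS.continuous_section rfl hτ).comp hdom
  refine h3.continuousAt.congr ?_
  have h4 := ((ActPair.continuous_elt (E := TensorStalk E)).tendsto
    (⟨x₀, y₀, t₀, g₀⟩ : ActPair (TensorStalk E))).eventually
    (hS.eventually_val_eq rfl hσ (e := ⟨y₀, t₀⟩) hσ₀.symm)
  have h5 := ((ActPair.continuous_arr (E := TensorStalk E)).tendsto
    (⟨x₀, y₀, t₀, g₀⟩ : ActPair (TensorStalk E))).eventually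
    (hB.isOpen.mem_nhds hgB)
  have h6 := (hdom.tendsto (⟨x₀, y₀, t₀, g₀⟩ : ActPair (TensorStalk E))).eventually h2
  have h7 := (hdom.tendsto (⟨x₀, y₀, t₀, g₀⟩ : ActPair (TensorStalk E))).eventually hbB
  filter_upwards [h4, h5, h6, h7] with p hp4 hp5 hp6 hp7
  obtain ⟨x, y, t, g⟩ := p
  have hbx : b x = ⟨y, g⟩ := Out.eq_of_mem hB hp7 hp5
  replace hp4 : t = σ y := hp4
  replace hp6 : τ x = act (b x).hom (σ (b x).cod) := hp6
  rw [hbx] at hp6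
  simp only [hp4, hp6]

/-- The graded `𝒢`-sheaf of `R`-modules `E ⊗_{𝒢_ε} 𝒢`. -/
noncomputable def tensor (E : GSheaf κ.Eps R) : GradedGSheaf κ R where
  stalk := TensorStalk E
  isLocalHomeomorph := isSheafFamily.isLocalHomeomorph_base rfl
  continuous_zero := isSheafFamily.continuous_zero rfl
  continuous_add := isSheafFamily.continuous_add rfl
  continuous_smul := isSheafFamily.continuous_smul rfl
  act g := act g
  continuous_act := continuous_act
  act_id x t := by
    refine LinearMap.congr_fun (f := act (𝟙 x)) (g := LinearMap.id) (hom_ext fun g e => ?_) t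
    rw [act_tmul]
    exact congrArg (fun f : x ⟶ g.cod => tmul (E := E) ⟨g.cod, f⟩ e) (Category.id_comp _)
  act_mul {x y z} h g t := by
    refine LinearMap.congr_fun (f := act h ∘ₗ act g) (g := act (h ≫ g)) (hom_ext fun k e => ?_) t
    rw [LinearMap.comp_apply, act_tmul, act_tmul, act_tmul]
    exact congrArg (fun f : x ⟶ k.cod => tmul (E := E) ⟨k.cod, f⟩ e) (Category.assoc _ _ _).symm
  comp := comp E
  isInternal _ := isInternal_comp
  isOpen_comp γ := by
    rw [isOpen_iff_mem_nhds]
    rintro e he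
    obtain ⟨σ, hσ, h, h1⟩ := exists_section_comp he
    filter_upwards [isSheafFamily.eventually_val_eq rfl hσ h.symm] with f hf
    change f.val ∈ comp E f.base γ
    rw [hf]
    exact h1 _
  act_mem g _ _ ht := act_mem_comp g ht

theorem map_tensorSection {F : GSheaf κ.Eps R} (φ : E ⟶ F) (s : ∀ y, E.stalk y) {f : Arr X → R}
    (hf : f ∈ steinberg X R) (x : X) :
    map φ x (tensorSection E s f x) = tensorSection F (fun y => φ.map y (s y)) f x := by
  rw [tensorSection, tensorSection]
  refine ((map φ x).toAddMonoidHom.map_finsum (tensorSection_finite s hf x)).trans ?_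
  refine finsum_congr fun g => ?_
  simp

theorem map_mem_tensorSections {F : GSheaf κ.Eps R} (φ : E ⟶ F) {σ : ∀ x, TensorStalk E x}
    (hσ : σ ∈ tensorSections E) : (fun x => map φ x (σ x)) ∈ tensorSections F := by
  induction hσ using Submodule.span_induction with
  | mem σ h =>
    obtain ⟨s, f, hs, hf, rfl⟩ := h
    have hc : Continuous fun y => (⟨y, φ.map y (s y)⟩ : Total F.stalk) :=
      φ.continuous_map.comp hs.continuous
    refine Submodule.subset_span ⟨fun y => φ.map y (s y), f, ⟨hc, ?_⟩, hf,
      funext fun x => map_tensorSection φ s hf x⟩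
    refine hs.isCompact_support.of_isClosed_subset (F.isClosed_support hc) fun y hy h => ?_
    exact hy (by rw [h, map_zero])
  | zero =>
    convert zero_mem (tensorSections F) using 1
    funext x
    simp
  | add σ τ _ _ h h' =>
    convert add_mem h h' using 1
    funext x
    simp
  | smul r σ _ h =>
    convert Submodule.smul_mem _ r h using 1
    funext x
    simp

/-- The graded morphism `φ ⊗ id`. -/
noncomputable def tensorMap {E F : GSheaf κ.Eps R} (φ : E ⟶ F) :
    GradedGSheaf.Hom (tensor E) (tensor F) where
  map := map φ
  continuous_map := by
    change Continuous fun e : Total (TensorStalk E) =>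
      (⟨e.base, map φ e.base e.val⟩ : Total (TensorStalk F))
    rw [continuous_iff_continuousAt]
    intro e
    have hS := isSheafFamily (E := E)
    obtain ⟨σ, hσ, h⟩ := hS.cover e.base e.val
    have hc : Continuous fun e : Total (TensorStalk E) =>
        (⟨e.base, map φ e.base (σ e.base)⟩ : Total (TensorStalk F)) :=
      ((isSheafFamily (E := F)).continuous_section rfl (map_mem_tensorSections φ hσ)).comp
        (hS.continuous_base rfl)
    refine hc.continuousAt.congr ?_
    filter_upwards [hS.eventually_val_eq rfl hσ h.symm] with f hf
    rw [hf]
  map_act {x y} g t := by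
    refine LinearMap.congr_fun (f := map φ x ∘ₗ act g) (g := act g ∘ₗ map φ y)
      (hom_ext fun k e => ?_) t
    rw [LinearMap.comp_apply, LinearMap.comp_apply, act_tmul, map_tmul, map_tmul, act_tmul]
  map_mem _ _ _ ht := map_mem_comp φ ht

end TensorStalk

/-- The induction functor `𝒥`, `E ↦ E ⊗_{𝒢_ε} 𝒢`. -/
noncomputable def inductionFunctor [AmpleGroupoid X] (κ : Grading X Γ) (R : Type v) [CommRing R] :
    GSheaf κ.Eps R ⥤ GradedGSheaf κ R where
  obj E := TensorStalk.tensor E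
  map φ := TensorStalk.tensorMap φ
  map_id E := by
    refine GradedGSheaf.Hom.ext (funext fun x => ?_)
    refine TensorStalk.hom_ext fun g e => ?_
    exact TensorStalk.map_tmul (𝟙 E) g e
  map_comp {E F G} φ ψ := by
    refine GradedGSheaf.Hom.ext (funext fun x => ?_)
    refine TensorStalk.hom_ext (E := E)
      (f' := TensorStalk.map ψ x ∘ₗ TensorStalk.map φ x) fun g e => ?_
    rw [LinearMap.comp_apply, TensorStalk.map_tmul, TensorStalk.map_tmul]
    exact TensorStalk.map_tmul (φ ≫ ψ) g e

end InductionFunctor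

end AmpleGrpd

open CategoryTheory AmpleGrpd

/-!
The grading is strong if and only if, for every object `x` and every degree `γ`, some arrow of
degree `γ` has domain `x` (`Grading.isStronglyGraded_iff`).

Both natural isomorphisms are evaluation, `e ⊗ g ↦ e g`. On `(E ⊗ 𝒢)_ε` evaluation is always
bijective, since every element of `(E ⊗ 𝒢^x)_ε` can be written uniquely as `e ⊗ 𝟙 x`; so `ℐ𝒥 ≅ id`
for every grading (`inductionRestrictionIso`). On `(E_ε ⊗ 𝒢^x)_γ ⟶ (E_x)_γ` it is bijective as soon
as there is an arrow `g` of degree `γ` with domain `x`, since multiplication by `g` identifies both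
sides with `(E_{𝐜(g)})_ε` (`TensorStalk.eval_bijOn`); so `𝒥ℐ ≅ id` if the grading is strong. In
both cases continuity is checked along finite sums of elementary sections
(`TensorStalk.continuous_of_form`), and the inverse is continuous because a continuous map over the
base between sheaf spaces is a local homeomorphism (`GSheaf.Hom.inverse`).

Conversely, if no arrow of degree `γ` leaves `x`, then `(E_ε ⊗ 𝒢^x)_γ = 0` for every `E`. But
`(E_x)_γ ≠ 0` for a shift by `γ⁻¹` of the sheaf induced from the constant sheaf `R`, because
`1 ⊗ 𝟙 x ≠ 0` (`exists_comp_ne_bot`); so `𝒥ℐ` is not isomorphic to the identity.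
-/

namespace AmpleGrpd

/-! ### Strong gradings and arrows of prescribed degree -/

section Criterion

variable {X : Type u} [Groupoid.{u} X] [TopologicalSpace (Arr X)] {Γ : Type w} [Group Γ]

/-- A grading is strong exactly when arrows of every degree leave every object. For one direction,
factor the identity arrow of `x` in `𝒢_{γ⁻¹} 𝒢_γ`; for the other, split off from `k ∈ 𝒢_{γδ}` any
arrow of degree `δ` with the same domain. -/
theorem Grading.isStronglyGraded_iff (κ : Grading X Γ) :
    κ.IsStronglyGraded ↔ ∀ (x : X) (γ : Γ), ∃ g : Out x, κ.deg g.hom = γ := by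
  constructor
  · intro h x γ
    have hx : unitArr x ∈ κ.component (γ⁻¹ * γ) := by
      rw [inv_mul_cancel]
      exact κ.deg_id x
    rw [← h] at hx
    obtain ⟨⟨s, m, t, a, b⟩, -, hb, hab⟩ := hx
    obtain rfl : s = x := congrArg Arr.dom hab
    exact ⟨⟨m, b⟩, hb⟩
  · intro h γ δ
    ext ⟨x, z, k⟩
    constructor
    · rintro ⟨p, hp, hq, hpq⟩
      rw [← hpq]
      exact (κ.deg_comp p.right p.left).trans (congrArg₂ _ hp hq)
    · intro hk
      obtain ⟨⟨y, g⟩, hg⟩ := h x δ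
      refine ⟨⟨x, y, z, Groupoid.inv g ≫ k, g⟩, ?_, hg, ?_⟩
      · change κ.deg (Groupoid.inv g ≫ k) = γ
        have hk' : κ.deg k = γ * δ := hk
        have hg' : κ.deg g = δ := hg
        rw [κ.deg_comp, κ.deg_inv, hk', hg', mul_inv_cancel_right]
      · simp [ComposablePair.mul]

end Criterion

/-! ### Morphisms that are bijective on stalks -/

section Isomorphisms

variable {X : Type u} [Groupoid.{u} X] [TopologicalSpace X] [TopologicalSpace (Arr X)]
  {R : Type v} [CommRing R]

namespace GSheaf

theorem act_inv_act (E : GSheaf X R) {x y : X} (g : x ⟶ y) (e : E.stalk y) :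
    E.act (Groupoid.inv g) (E.act g e) = e := by
  rw [E.act_mul, Groupoid.inv_comp, E.act_id]

theorem act_act_inv (E : GSheaf X R) {x y : X} (g : x ⟶ y) (e : E.stalk x) :
    E.act g (E.act (Groupoid.inv g) e) = e := by
  rw [E.act_mul, Groupoid.comp_inv, E.act_id]

/-- The inverse of a morphism that is bijective on stalks. It is continuous because a morphism
over `X` between sheaf spaces is a local homeomorphism. -/
noncomputable def Hom.inverse {E F : GSheaf X R} (φ : Hom E F)
    (h : ∀ x, Function.Bijective (φ.map x)) : Hom F E where
  map x := (LinearEquiv.ofBijective (φ.map x) (h x)).symm.toLinearMap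
  continuous_map := by
    have hφ : IsLocalHomeomorph
        fun e : Total E.stalk => (⟨e.base, φ.map e.base e.val⟩ : Total F.stalk) :=
      IsLocalHomeomorph.of_comp (g := (Total.base : Total F.stalk → X))
        E.isLocalHomeomorph F.isLocalHomeomorph φ.continuous_map
    refine ⟨fun U hU => ?_⟩
    convert hφ.isOpenMap U hU
    ext ⟨x, f⟩
    constructor
    · intro hf
      exact ⟨_, hf, Total.ext rfl (heq_of_eq
        ((LinearEquiv.ofBijective (φ.map x) (h x)).apply_symm_apply f))⟩
    · rintro ⟨⟨y, e⟩, he, hef⟩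
      obtain ⟨rfl, hef⟩ := Total.mk.inj hef
      obtain rfl := eq_of_heq hef
      change (⟨y, (LinearEquiv.ofBijective (φ.map y) (h y)).symm (φ.map y e)⟩ : Total E.stalk) ∈ U
      rwa [show (LinearEquiv.ofBijective (φ.map y) (h y)).symm (φ.map y e) = e from
        (LinearEquiv.ofBijective (φ.map y) (h y)).symm_apply_apply e]
  map_act {x y} g f := by
    obtain ⟨e, rfl⟩ := (h y).2 f
    have hs : ∀ (z : X) (e : E.stalk z),
        (LinearEquiv.ofBijective (φ.map z) (h z)).symm (φ.map z e) = e :=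
      fun z e => (LinearEquiv.ofBijective (φ.map z) (h z)).symm_apply_apply e
    simp only [LinearEquiv.coe_coe, ← φ.map_act, hs]

theorem Hom.inverse_map_map {E F : GSheaf X R} (φ : Hom E F)
    (h : ∀ x, Function.Bijective (φ.map x)) (x : X) (e : E.stalk x) :
    (φ.inverse h).map x (φ.map x e) = e :=
  (LinearEquiv.ofBijective (φ.map x) (h x)).symm_apply_apply e

theorem Hom.map_inverse_map {E F : GSheaf X R} (φ : Hom E F)
    (h : ∀ x, Function.Bijective (φ.map x)) (x : X) (f : F.stalk x) :
    φ.map x ((φ.inverse h).map x f) = f :=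
  (LinearEquiv.ofBijective (φ.map x) (h x)).apply_symm_apply f

/-- A morphism that is bijective on stalks, as an isomorphism. -/
noncomputable def isoOfBijective {E F : GSheaf X R} (φ : E ⟶ F)
    (h : ∀ x, Function.Bijective (φ.map x)) : E ≅ F where
  hom := φ
  inv := Hom.inverse φ h
  hom_inv_id := Hom.ext (funext fun x => LinearMap.ext (Hom.inverse_map_map φ h x))
  inv_hom_id := Hom.ext (funext fun x => LinearMap.ext (Hom.map_inverse_map φ h x))

end GSheaf

namespace GradedGSheaf

variable {Γ : Type w} [Group Γ] {κ : Grading X Γ}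

/-- Injectivity on homogeneous components gives injectivity because the components of the target
are independent. -/
theorem Hom.bijective_of_bijOn {E F : GradedGSheaf κ R} (φ : Hom E F)
    (h : ∀ x γ, Set.BijOn (φ.map x) (E.comp x γ) (F.comp x γ)) (x : X) :
    Function.Bijective (φ.map x) := by
  classical
  have hE := (DirectSum.isInternal_submodule_iff_iSupIndep_and_iSup_eq_top _).1 (E.isInternal x)
  have hF := (DirectSum.isInternal_submodule_iff_iSupIndep_and_iSup_eq_top _).1 (F.isInternal x)
  constructor
  · rw [injective_iff_map_eq_zero]
    intro e he
    have heT : e ∈ ⨆ γ, E.comp x γ := hE.2 ▸ Submodule.mem_top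
    obtain ⟨f, hf, rfl⟩ := (Submodule.mem_iSup_iff_exists_finsupp _ _).1 heT
    rw [Finsupp.sum, map_sum] at he
    have h0 := (iSupIndep_iff_finsetSum_eq_zero_imp_eq_zero _).1 hF.1 f.support
      (fun γ => φ.map x (f γ)) (fun γ _ => φ.map_mem x γ _ (hf γ)) he
    refine Finset.sum_eq_zero fun γ hγ => ?_
    exact (h x γ).injOn (hf γ) (zero_mem _) ((h0 γ hγ).trans (map_zero _).symm)
  · rw [← LinearMap.range_eq_top, eq_top_iff, ← hF.2]
    refine iSup_le fun γ f hf => ?_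
    obtain ⟨e, -, rfl⟩ := (h x γ).surjOn hf
    exact ⟨e, rfl⟩

/-- A graded morphism that is bijective on homogeneous components, as an isomorphism. -/
noncomputable def isoOfBijOn {E F : GradedGSheaf κ R} (φ : E ⟶ F)
    (h : ∀ x γ, Set.BijOn (φ.map x) (E.comp x γ) (F.comp x γ)) : E ≅ F where
  hom := φ
  inv :=
    { GSheaf.Hom.inverse φ.toHom (Hom.bijective_of_bijOn φ h) with
      map_mem := by
        intro x γ f hf
        obtain ⟨e, he, rfl⟩ := (h x γ).surjOn hf
        rw [GSheaf.Hom.inverse_map_map]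
        exact he }
  hom_inv_id := Hom.ext (funext fun x => LinearMap.ext
    (GSheaf.Hom.inverse_map_map φ.toHom (Hom.bijective_of_bijOn φ h) x))
  inv_hom_id := Hom.ext (funext fun x => LinearMap.ext
    (GSheaf.Hom.map_inverse_map φ.toHom (Hom.bijective_of_bijOn φ h) x))

end GradedGSheaf

end Isomorphisms

/-! ### The evaluation maps `e ⊗ g ↦ e g` -/

section Counits

variable {X : Type u} [Groupoid.{u} X] [TopologicalSpace X] [TopologicalSpace (Arr X)]
  {Γ : Type w} [Group Γ] {κ : Grading X Γ} {R : Type v} [CommRing R]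

namespace TensorStalk

theorem tmul_transport_of_mem {E : GSheaf κ.Eps R} {x : X} (h : Out x) {t : TensorStalk E x}
    (ht : t ∈ comp E x (κ.deg h.hom)) : tmul h (transport h t) = t := by
  rw [tmul_transport, proj_of_mem ht]

theorem transport_tmul_self {E : GSheaf κ.Eps R} {x : X} (h : Out x) (e : E.stalk ⟨h.cod⟩) :
    transport h (tmul h e) = e := by
  rw [transport_tmul, dif_pos rfl]
  refine Eq.trans (congrArg (fun k => E.act k e) (Subtype.ext ?_)) (E.act_id _ e)
  exact Groupoid.inv_comp h.hom

theorem transport_map {E F : GSheaf κ.Eps R} (φ : E ⟶ F) {x : X} (h : Out x)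
    (t : TensorStalk E x) : transport h (map φ x t) = φ.map ⟨h.cod⟩ (transport h t) := by
  refine LinearMap.congr_fun (f := transport h ∘ₗ map φ x) (g := φ.map ⟨h.cod⟩ ∘ₗ transport h)
    (hom_ext fun g e => ?_) t
  rw [LinearMap.comp_apply, LinearMap.comp_apply, map_tmul, transport_tmul, transport_tmul]
  split_ifs
  · exact (φ.map_act _ e).symm
  · exact (map_zero _).symm

theorem transport_id_act {E : GSheaf κ.Eps R} {x y : κ.Eps} (g : x ⟶ y)
    (t : TensorStalk E y.obj) :
    transport (⟨x.obj, 𝟙 x.obj⟩ : Out x.obj) (act g.1 t) =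
      E.act g (transport (⟨y.obj, 𝟙 y.obj⟩ : Out y.obj) t) := by
  refine LinearMap.congr_fun (f := transport (⟨x.obj, 𝟙 x.obj⟩ : Out x.obj) ∘ₗ act g.1)
    (g := E.act g ∘ₗ transport (⟨y.obj, 𝟙 y.obj⟩ : Out y.obj)) (hom_ext fun k e => ?_) t
  have hd : κ.deg (g.1 ≫ k.hom) = κ.deg k.hom := by rw [κ.deg_comp, g.2, mul_one]
  rw [LinearMap.comp_apply, LinearMap.comp_apply, act_tmul, transport_tmul, transport_tmul]
  by_cases h : κ.deg k.hom = 1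
  · rw [dif_pos (hd.trans (h.trans (κ.deg_id x.obj).symm)), dif_pos (h.trans (κ.deg_id y.obj).symm),
      E.act_mul]
    refine congrArg (fun l => E.act l e) (Subtype.ext ?_)
    change Groupoid.inv (𝟙 x.obj) ≫ g.1 ≫ k.hom = g.1 ≫ Groupoid.inv (𝟙 y.obj) ≫ k.hom
    simp
  · rw [dif_neg fun h' => h (hd.symm.trans (h'.trans (κ.deg_id x.obj))),
      dif_neg fun h' => h (h'.trans (κ.deg_id y.obj)), map_zero]

/-- Evaluation `e ⊗ g ↦ e g` on the stalk of `E_ε ⊗ 𝒢` at `x`. -/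
noncomputable def eval (E : GradedGSheaf κ R) (x : X) : TensorStalk E.eps x →ₗ[R] E.stalk x :=
  lift (fun g => E.act g.hom ∘ₗ (E.comp g.cod 1).subtype) fun _ _ g h e =>
    E.act_mul g h.1 e.1

theorem eval_tmul (E : GradedGSheaf κ R) {x : X} (g : Out x) (e : E.eps.stalk ⟨g.cod⟩) :
    eval E x (tmul g e) = E.act g.hom e.1 :=
  lift_tmul _ _ g e

theorem eval_act (E : GradedGSheaf κ R) {x y : X} (g : x ⟶ y) (t : TensorStalk E.eps y) :
    eval E x (act g t) = E.act g (eval E y t) := by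
  refine LinearMap.congr_fun (f := eval E x ∘ₗ act g) (g := E.act g ∘ₗ eval E y)
    (hom_ext fun k e => ?_) t
  rw [LinearMap.comp_apply, LinearMap.comp_apply, act_tmul, eval_tmul, eval_tmul, E.act_mul]

theorem eval_mem (E : GradedGSheaf κ R) {x : X} {γ : Γ} {t : TensorStalk E.eps x}
    (ht : t ∈ comp E.eps x γ) : eval E x t ∈ E.comp x γ := by
  suffices h : comp E.eps x γ ≤ (E.comp x γ).comap (eval E x) from h ht
  refine Submodule.span_le.2 ?_
  rintro _ ⟨g, e, rfl, rfl⟩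
  change eval E x (tmul g e) ∈ E.comp x (κ.deg g.hom)
  rw [eval_tmul]
  simpa using E.act_mem g.hom 1 e.1 e.2

theorem eval_map {E F : GradedGSheaf κ R} (φ : E ⟶ F) (x : X) (t : TensorStalk E.eps x) :
    eval F x (map (GradedGSheaf.epsMap φ) x t) = φ.map x (eval E x t) := by
  refine LinearMap.congr_fun
    (f := eval F x ∘ₗ map (E := E.eps) (F := F.eps) (GradedGSheaf.epsMap φ) x)
    (g := φ.map x ∘ₗ eval E x) (hom_ext fun k e => ?_) t
  rw [LinearMap.comp_apply, LinearMap.comp_apply, map_tmul, eval_tmul, eval_tmul, φ.map_act]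
  rfl

/-- Multiplication by an arrow `g` of degree `γ` leaving `x` identifies `(E_{𝐜(g)})_ε` both with
`(E_ε ⊗ 𝒢^x)_γ` and with `(E_x)_γ`. -/
theorem eval_bijOn (E : GradedGSheaf κ R) {x : X} {γ : Γ} (g : Out x) (hg : κ.deg g.hom = γ) :
    Set.BijOn (eval E x) (comp E.eps x γ) (E.comp x γ) := by
  subst hg
  refine ⟨fun t ht => eval_mem E ht, fun s hs t ht hst => ?_, fun e he => ?_⟩
  · have key : ∀ {t}, t ∈ comp E.eps x (κ.deg g.hom) →
        E.act (Groupoid.inv g.hom) (eval E x t) = (transport g t).1 := fun {t} ht => by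
      conv_lhs => rw [← tmul_transport_of_mem g ht]
      rw [eval_tmul]
      exact E.act_inv_act g.hom _
    have h : transport g s = transport g t :=
      Subtype.ext ((key hs).symm.trans ((congrArg _ hst).trans (key ht)))
    rw [← tmul_transport_of_mem g hs, h, tmul_transport_of_mem g ht]
  · have h1 : E.act (Groupoid.inv g.hom) e ∈ E.comp g.cod 1 := by
      have := E.act_mem (Groupoid.inv g.hom) _ e he
      rwa [κ.deg_inv, mul_inv_cancel] at this
    refine ⟨tmul g (⟨_, h1⟩ : E.comp g.cod 1), Submodule.subset_span ⟨g, _, rfl, rfl⟩, ?_⟩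
    exact (eval_tmul E g _).trans (E.act_act_inv g.hom e)

variable [AmpleGroupoid X]

/-- A map out of `E ⊗ 𝒢` is continuous if it is continuous along all finite sums of continuous
elementary sections, because every point lies on a section that locally is such a sum. -/
theorem continuous_of_form {E : GSheaf κ.Eps R} {Y : Type*} [TopologicalSpace Y]
    (f : Total (TensorStalk E) → Y)
    (hf : ∀ (x₀ : X) (l : List ((∀ x : X, Out x) × (∀ y, E.stalk y))), (∀ p ∈ l, Good x₀ p) →
      ContinuousAt (fun x => f ⟨x, form l x⟩) x₀) : Continuous f := by
  rw [continuous_iff_continuousAt]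
  intro e
  have hS := isSheafFamily (E := E)
  obtain ⟨σ, hσ, h⟩ := hS.cover e.base e.val
  obtain ⟨l, hl, hσl⟩ := hasForm_of_mem hσ e.base
  have hb : ContinuousAt (Total.base : Total (TensorStalk E) → X) e :=
    (hS.continuous_base rfl).continuousAt
  refine (ContinuousAt.comp (f := (Total.base : Total (TensorStalk E) → X)) (x := e)
    (hf e.base l hl) hb).congr ?_
  filter_upwards [hS.eventually_val_eq rfl hσ h.symm, hb.eventually hσl] with e' h1 h2
  exact congrArg f (Total.ext rfl (heq_of_eq (h1.trans h2).symm))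

theorem continuousAt_eval_form (E : GradedGSheaf κ R) (x₀ : X)
    (l : List ((∀ x : X, Out x) × (∀ y, E.eps.stalk y))) (hl : ∀ p ∈ l, Good x₀ p) :
    ContinuousAt (fun x => (⟨x, eval E x (form l x)⟩ : Total E.stalk)) x₀ := by
  induction l with
  | nil =>
    simp only [form, List.map_nil, List.sum_nil, map_zero]
    exact E.continuous_zero.continuousAt
  | cons p l ih =>
    simp only [form, List.map_cons, List.sum_cons, map_add]
    refine E.continuousAt_add ?_ (ih fun q hq => hl q (List.mem_cons_of_mem _ hq))
    have hp := hl p List.mem_cons_self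
    simp only [eval_tmul]
    exact E.continuousAt_act
      (p := fun x => ⟨x, (p.1 x).cod, (p.2 ⟨(p.1 x).cod⟩).1, (p.1 x).hom⟩)
      (E.isInducing_epsIncl.continuous.continuousAt.comp hp.continuousAt_val) hp.fst

/-- The counit `E_ε ⊗ 𝒢 ⟶ E`, `e ⊗ g ↦ e g`. -/
noncomputable def evalHom (E : GradedGSheaf κ R) : GradedGSheaf.Hom (tensor E.eps) E where
  map := eval E
  continuous_map := continuous_of_form _ (continuousAt_eval_form E)
  map_act g t := eval_act E g t
  map_mem _ _ _ ht := eval_mem E ht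

/-- The morphism `(E ⊗ 𝒢)_ε ⟶ E`, `e ⊗ g ↦ e g`. -/
noncomputable def epsEvalHom (E : GSheaf κ.Eps R) : GSheaf.Hom (tensor E).eps E where
  map x := (transport (⟨x.obj, 𝟙 x.obj⟩ : Out x.obj)).domRestrict (comp E x.obj 1)
  continuous_map := by
    have h : Continuous fun e : Total (TensorStalk E) => (⟨⟨e.base⟩,
        transport (⟨e.base, 𝟙 e.base⟩ : Out e.base) e.val⟩ : Total E.stalk) := by
      refine continuous_of_form _ fun x₀ l hl => ?_
      refine continuousAt_transport_form (q := (fun x => ⟨x, 𝟙 x⟩, 0)) ⟨?_, E.continuous_zero⟩ l hl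
      exact (TopologicalGroupoid.isInducing_unit (X := X)).continuous.continuousAt
    exact h.comp (tensor E).isInducing_epsIncl.continuous
  map_act g t := transport_id_act g t.1

theorem epsEvalHom_bijective (E : GSheaf κ.Eps R) (x : κ.Eps) :
    Function.Bijective ((epsEvalHom E).map x) := by
  have hdeg : κ.deg (⟨x.obj, 𝟙 x.obj⟩ : Out x.obj).hom = 1 := κ.deg_id x.obj
  constructor
  · rintro ⟨s, hs⟩ ⟨t, ht⟩ hst
    refine Subtype.ext ?_
    change s ∈ comp E x.obj 1 at hs
    change t ∈ comp E x.obj 1 at ht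
    rw [← hdeg] at hs ht
    exact (tmul_transport_of_mem _ hs).symm.trans
      ((congrArg _ hst).trans (tmul_transport_of_mem _ ht))
  · intro e
    have he : tmul (⟨x.obj, 𝟙 x.obj⟩ : Out x.obj) e ∈ comp E x.obj 1 :=
      Submodule.subset_span ⟨_, e, hdeg, rfl⟩
    exact ⟨⟨_, he⟩, transport_tmul_self (⟨x.obj, 𝟙 x.obj⟩ : Out x.obj) e⟩

end TensorStalk

variable [AmpleGroupoid X]

/-- `ℐ𝒥 ≅ id` holds for every grading: the component of degree `ε` of `E ⊗ 𝒢^x` consists of the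
`e ⊗ 𝟙 x`. -/
noncomputable def inductionRestrictionIso (κ : Grading X Γ) (R : Type v) [CommRing R] :
    inductionFunctor κ R ⋙ restrictionFunctor κ R ≅ 𝟭 (GSheaf κ.Eps R) :=
  NatIso.ofComponents
    (fun E => GSheaf.isoOfBijective (TensorStalk.epsEvalHom E) (TensorStalk.epsEvalHom_bijective E))
    fun φ => GSheaf.Hom.ext <| funext fun _ => LinearMap.ext fun t =>
      TensorStalk.transport_map φ _ t.1

/-- `𝒥ℐ ≅ id` holds as soon as arrows of every degree leave every object. -/
noncomputable def restrictionInductionIso (κ : Grading X Γ) (R : Type v) [CommRing R]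
    (h : ∀ (x : X) (γ : Γ), ∃ g : Out x, κ.deg g.hom = γ) :
    restrictionFunctor κ R ⋙ inductionFunctor κ R ≅ 𝟭 (GradedGSheaf κ R) :=
  NatIso.ofComponents
    (fun E => GradedGSheaf.isoOfBijOn (TensorStalk.evalHom E) fun x γ =>
      (h x γ).elim fun g hg => TensorStalk.eval_bijOn E g hg)
    fun φ => GradedGSheaf.Hom.ext <| funext fun x => LinearMap.ext fun t =>
      TensorStalk.eval_map φ x t

end Counits

/-! ### Shifts of induced constant sheaves -/

section Converse

variable {X : Type u} [Groupoid.{u} X] [TopologicalSpace X] [TopologicalSpace (Arr X)]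
  {Γ : Type w} [Group Γ] {κ : Grading X Γ} {R : Type v} [CommRing R]

/-- The shift `E(δ)` of a graded sheaf, `(E(δ)_x)_γ = (E_x)_{δγ}`. -/
def GradedGSheaf.shift (E : GradedGSheaf κ R) (δ : Γ) : GradedGSheaf κ R where
  toGSheaf := E.toGSheaf
  comp x γ := E.comp x (δ * γ)
  isInternal x := by
    classical
    have h := (DirectSum.isInternal_submodule_iff_iSupIndep_and_iSup_eq_top _).1 (E.isInternal x)
    have h' := (DirectSum.isInternal_submodule_iff_iSupIndep_and_iSup_eq_top
      fun γ => E.comp x (δ * γ)).2 ⟨h.1.comp (mul_right_injective δ),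
        ((Equiv.mulLeft δ).iSup_comp (g := E.comp x)).trans h.2⟩
    -- The two sides differ in the decidability instance on `Γ` only.
    convert h'
  isOpen_comp γ := E.isOpen_comp (δ * γ)
  act_mem g γ e he := by
    rw [← mul_assoc]
    exact E.act_mem g (δ * γ) e he

/-- The constant sheaf with stalk `R` and trivial action. Its topology is the one generated by the
constant sections over the compact open sets. -/
noncomputable def GSheaf.const (X : Type u) [Groupoid.{u} X] [TopologicalSpace X]
    [TopologicalSpace (Arr X)] (R : Type v) [CommRing R]
    (hX : IsTopologicalBasis {U : Set X | IsCompact U ∧ IsOpen U})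
    (hd : Continuous (Arr.dom : Arr X → X)) : GSheaf X R :=
  let S : Submodule R (X → ULift.{u} R) := LinearMap.range (LinearMap.pi fun _ => LinearMap.id)
  letI : TopologicalSpace (Total fun _ : X => ULift.{u} R) := sectionTopology S
  have hS : IsSheafFamily S :=
    { basis := hX
      cover := fun _ e => ⟨_, ⟨e, rfl⟩, rfl⟩
      eventually_zero := by
        rintro _ ⟨e, rfl⟩ x h
        exact Filter.Eventually.of_forall fun _ => h }
  { stalk := fun _ => ULift.{u} R
    isLocalHomeomorph := hS.isLocalHomeomorph_base rfl
    continuous_zero := hS.continuous_zero rfl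
    continuous_add := hS.continuous_add rfl
    continuous_smul := hS.continuous_smul rfl
    act := fun _ => LinearMap.id
    continuous_act := by
      rw [continuous_iff_continuousAt]
      rintro p
      have hp : (fun _ : X => p.elt) ∈ S := ⟨p.elt, rfl⟩
      refine ((hS.continuous_section rfl hp).comp
        (hd.comp ActPair.continuous_arr)).continuousAt.congr ?_
      filter_upwards [ActPair.continuous_elt.continuousAt.eventually
        (hS.eventually_val_eq rfl hp (e := ⟨p.cod, p.elt⟩) rfl)] with q hq
      exact Total.ext rfl (heq_of_eq hq.symm)
    act_id := fun _ _ => rfl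
    act_mul := fun _ _ _ => rfl }

variable [AmpleGroupoid X]

theorem isTopologicalBasis_epsUnits (κ : Grading X Γ) :
    IsTopologicalBasis {U : Set κ.Eps | IsCompact U ∧ IsOpen U} := by
  convert isTopologicalBasis_units.isInducing (epsHomeomorph κ).isInducing using 1
  ext U
  constructor
  · rintro ⟨hc, ho⟩
    exact ⟨epsHomeomorph κ '' U, ⟨hc.image (epsHomeomorph κ).continuous,
      (epsHomeomorph κ).isOpenMap U ho⟩, (epsHomeomorph κ).preimage_image U⟩
  · rintro ⟨V, ⟨hc, ho⟩, rfl⟩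
    exact ⟨(epsHomeomorph κ).isCompact_preimage.2 hc, ho.preimage (epsHomeomorph κ).continuous⟩

theorem continuous_epsDom (κ : Grading X Γ) : Continuous (Arr.dom : Arr κ.Eps → κ.Eps) :=
  continuous_induced_rng.2 (continuous_dom.comp (continuous_induced_dom (f := κ.epsArr)))

/-- Some graded sheaf has a nonzero component of degree `γ` at `x`: a shift of the sheaf induced
from a constant sheaf. -/
theorem exists_comp_ne_bot (κ : Grading X Γ) (R : Type v) [CommRing R] [Nontrivial R] (x : X)
    (γ : Γ) : ∃ E : GradedGSheaf κ R, E.comp x γ ≠ ⊥ := by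
  let C : GSheaf κ.Eps R := GSheaf.const κ.Eps R (isTopologicalBasis_epsUnits κ)
    (continuous_epsDom κ)
  refine ⟨(TensorStalk.tensor C).shift γ⁻¹, ?_⟩
  let i : Out x := ⟨x, 𝟙 x⟩
  let c : C.stalk ⟨i.cod⟩ := (ULift.up 1 : ULift.{u} R)
  have hc : c ≠ 0 := fun h => one_ne_zero (congrArg ULift.down h)
  refine (Submodule.ne_bot_iff _).2 ⟨TensorStalk.tmul i c, ?_, fun h => hc ?_⟩
  · change TensorStalk.tmul i c ∈ TensorStalk.comp C x (γ⁻¹ * γ)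
    rw [inv_mul_cancel]
    exact Submodule.subset_span ⟨i, c, κ.deg_id x, rfl⟩
  · have h' : TensorStalk.tmul (E := C) i c = 0 := h
    rw [← TensorStalk.transport_tmul_self i c, h', map_zero]

/-- If no arrow of degree `γ` leaves `x`, then every graded sheaf of the form `E_ε ⊗ 𝒢` has zero
`γ`-component at `x`, whereas some graded sheaf does not. -/
theorem exists_deg_eq_of_iso [Nontrivial R]
    (α : restrictionFunctor κ R ⋙ inductionFunctor κ R ≅ 𝟭 (GradedGSheaf κ R)) (x : X) (γ : Γ) :
    ∃ g : Out x, κ.deg g.hom = γ := by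
  by_contra hne
  obtain ⟨E, hE⟩ := exists_comp_ne_bot κ R x γ
  obtain ⟨e, he, he0⟩ := (Submodule.ne_bot_iff _).1 hE
  -- The `γ`-component of `E_ε ⊗ 𝒢^x` is the span of the empty set.
  have hbot : TensorStalk.comp E.eps x γ = ⊥ := by
    refine Submodule.span_eq_bot.2 ?_
    rintro _ ⟨g, f, hg, rfl⟩
    exact absurd ⟨g, hg⟩ hne
  let β : GradedGSheaf.Hom E (TensorStalk.tensor E.eps) := α.inv.app E
  let β' : GradedGSheaf.Hom (TensorStalk.tensor E.eps) E := α.hom.app E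
  have hβ : β.map x e = 0 := by
    have h : β.map x e ∈ TensorStalk.comp E.eps x γ := β.map_mem x γ e he
    exact (Submodule.mem_bot R).1 (hbot.le h)
  have hββ : β'.map x (β.map x e) = e :=
    congrArg (fun φ : GradedGSheaf.Hom E E => φ.map x e) (α.inv_hom_id_app E)
  exact he0 (by rw [← hββ, hβ, map_zero])

end Converse

end AmpleGrpd

open CategoryTheory AmpleGrpd

theorem theorem3p7 {X : Type u} [Groupoid.{u} X] [TopologicalSpace X] [TopologicalSpace (Arr X)]
    [AmpleGroupoid X] {Γ : Type w} [Group Γ] (κ : Grading X Γ) (R : Type v) [CommRing R]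
    [Nontrivial R] :
    κ.IsStronglyGraded ↔
      Nonempty (restrictionFunctor κ R ⋙ inductionFunctor κ R ≅ 𝟭 (GradedGSheaf κ R)) ∧
      Nonempty (inductionFunctor κ R ⋙ restrictionFunctor κ R ≅ 𝟭 (GSheaf κ.Eps R)) := by
  rw [κ.isStronglyGraded_iff]
  exact ⟨fun h => ⟨⟨restrictionInductionIso κ R h⟩, ⟨inductionRestrictionIso κ R⟩⟩,
    fun ⟨⟨α⟩, _⟩ => exists_deg_eq_of_iso α⟩
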